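/- **Setting.** Let $\mathbb E_1,\mathbb E_2$ be finite-dimensional Euclidean spaces, $\mathcal M\subset\mathbb E_1$ a compact embedded submanifold with tangent spaces $T_x\mathcal M$ and normal spaces $N_x\mathcal M=(T_x\mathcal M)^\perp$, and $S\subset\mathbb E_2$ a compact convex set. Consider $$\min_{x\in\mathcal M}\max_{y\in S}F(x,y):=f(x,y)+h(x)-g(y),$$ where $f:\mathbb E_1\times\mathbb E_2\to\mathbb R$ is continuously differentiable and concave in $y$, and $h:\mathbb E_1\to\mathbb R$, $g:\mathbb E_2\to\mathbb R$ are convex. Assume that $h$ is $L_h$-Lipschitz and that for some $L_x,L_y>0$: $\|\nabla_xf(x_1,y)-\nabla_xf(x_2,y)\|\le L_x\|x_1-x_2\|$ for $x_1,x_2\in\operatorname{conv}\mathcal M$, $y\in S$; and $\|\nabla_yf(x_1,y_1)-\nabla_yf(x_2,y_2)\|^2\le L_y^2(\|x_1-x_2\|^2+\|y_1-y_2\|^2)$ for $(x_i,y_i)\in\mathcal M\times S$. Put $\sigma_y=\sup_{y\in S}\|y\|$ and $G=\sup_{\mathcal M\times S}\|\nabla_xf\|$. Let $R:T\mathcal M\to\mathcal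 M$ be a retraction. **Stationarity.** For $\beta>0$ let $\mathcal G^\beta(x,y)=\max\{\|\beta u\|,\operatorname{dist}(0,\nabla_yf(x,y)-\partial g(y)-N_yS)\}$ with $u=\operatorname{argmin}_{v\in T_x\mathcal M}\langle\nabla_xf(x,y),v\rangle+h(x+v)+\frac\beta2\|v\|^2$. A point $(x,y)\in\mathcal M\times S$ is $\varepsilon$-game-stationary if $\mathcal G^\beta(x,y)\le\varepsilon$ for some $\beta>0$. Let $\Phi(x)=\max_{y\in S}f(x,y)-g(y)$ and $\partial_\varepsilon\Phi(x)=\{z:\Phi(x)+\langle z,w-x\rangle-\varepsilon\le\Phi(w)+\frac{L_x}2\|w-x\|^2\ \forall w\in\mathbb E_1\}$. A point $x\in\mathcal M$ is $\varepsilon$-optimization-stationary if there is $u\in\mathbb E_1$ with $\max\{\|u\|,\operatorname{dist}(0,\partial_\varepsilon\Phi(x+u)+\partial h(x+u)+N_x\mathcal M)\}<\varepsilon$. **Algorithm (MPGDA-PGA).** Parameters: $c_1,\eta\in(0,1)$, $\kappa>15$, $0<\rho\le(1-2(\kappa+1)^{-1/4})/L_y$, $\gamma_k=\dfrac{2}{\rho(k+\kappa+2)^{1/4}}$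 for $k\ge-1$, $0<\hat l_{\min}<\hat l_{\max}$, $x_0\in\mathcal M$, $y_{-1}\in S$. Let $$\hat y_k(x)=\operatorname*{argmax}_{y\in S}\ \langle\nabla_yf(x,y_k)-\gamma_ky_k,\,y-y_k\rangle-\tfrac1{2\rho}\|y-y_k\|^2-g(y),$$ $$\mathcal F_k(x,y)=F(x,y)-\tfrac{\gamma_{k-1}}2\|y\|^2+\tfrac1{2\rho}\|y-y_{k-1}\|^2+\Big(\tfrac4\rho\tfrac{\gamma_{k-1}}{\gamma_k}+\tfrac{\gamma_{k-1}}2\Big)\sigma_y^2+\Big(\tfrac4{\rho^2\gamma_k}-\tfrac4\rho\Big)\|y-y_{k-1}\|^2+\tfrac4\rho\Big(1-\tfrac{\gamma_{k-1}}{\gamma_k}\Big)\|y\|^2.$$ Set $y_0=\hat y_{-1}(x_0)$. For $k=0,1,\dots$: choose $l_k\in[\hat l_{\min},\hat l_{\max}]$ and put $\beta_k=l_k/\gamma_k^2$; let $v_k=\operatorname{argmin}_{v\in T_{x_k}\mathcal M}\langle\nabla_xf(x_k,y_k),v\rangle+h(x_k+v)+\frac{\beta_k}2\|v\|^2$; find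 the smallest integer $j\ge0$ such that $x_k^j=R_{x_k}(\eta^jv_k)$ satisfies $$\mathcal F_{k+1}(x_k^j,\hat y_k(x_k^j))\le\mathcal F_k(x_k,y_k)-c_1\eta^j\beta_k\|v_k\|^2-\tfrac1{10\rho}\|\hat y_k(x_k^j)-y_k\|^2;$$ set $x_{k+1}=x_k^j$ and $y_{k+1}=\hat y_k(x_{k+1})$. Let $T(\varepsilon)=\min\{k\ge0:\mathcal G^{\beta_k}(x_k,y_k)<\varepsilon\}$. **Theorem.** There are constants $M_1,M_2>0$ with $\|R_x(v)-x\|\le M_1\|v\|$ and $\|R_x(v)-(x+v)\|\le M_2\|v\|^2$ for all $x\in\mathcal M$, $v\in T_x\mathcal M$, and the algorithm is well defined: for every $x_0\in\mathcal M$, $y_{-1}\in S$ and every choice of the $l_k$ it generates infinite sequences, every line search being finite. For any such $M_1,M_2$ put $$b_1=M_2(L_h+G)+\tfrac{M_1^2(L_x+\rho L_y^2)}2,\quad J_2=\max\Big\{\Big\lceil\log_\eta\frac{\rho(1-c_1)\hat l_{\min}}{\rho b_1\gamma_{-1}^2+8L_y^2M_1^2}\Big\rceil,0\Big\},\quad C_1=\min\Big\{\frac{4c_1\eta^{J_2}}{\hat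 l_{\max}\rho^2},\frac{\rho(\kappa+2)^{1/2}}{10}\Big\},$$ $$\overline{\mathcal F}=\sup_{\mathcal M\times S}F+\Big(\tfrac6\rho+\tfrac{16}{\rho^2\gamma_0}+\tfrac{4\gamma_{-1}}{\rho\gamma_0}+\tfrac{\gamma_{-1}}2\Big)\sigma_y^2,\qquad\underline{\mathcal F}=\inf_{\mathcal M\times S}F-\Big(\tfrac{\gamma_{-1}}2+\tfrac{24}\rho\Big)\sigma_y^2.$$ Then for every sequence generated by the algorithm and every $\varepsilon>0$, $T(\varepsilon)$ exists and $$T(\varepsilon)\le\frac{\big((15+4\kappa)^{1/4}\,(2(\overline{\mathcal F}-\underline{\mathcal F})/C_1)^{1/2}\,(\rho L_y+1)+2\sigma_y/\rho\big)^4}{\varepsilon^4}.$$ Consequently there is a constant $K>0$, depending only on the problem, the retraction and the parameters $c_1,\eta,\kappa,\rho,\hat l_{\min},\hat l_{\max}$, such that for every generated sequence and every $\varepsilon>0$ some $(x_k,y_k)$ with $k\le K/\varepsilon^4$ is $\varepsilon$-game-stationary. If moreover the two Lipschitz conditions on $\nabla_xf$ and $\nabla_yf$ hold for all $x_1,x_2\in\mathbb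 E_1$ (and $y,y_1,y_2\in S$), there is likewise such a $K$ for which, for every generated sequence and every $\varepsilon>0$, some $x_k$ with $k\le K/\varepsilon^4$ is $\varepsilon$-optimization-stationary. -/

import Mathlib

open scoped ContDiff InnerProductSpace

noncomputable section

namespace ManifoldMinimax

section Geometry

variable {E : Type*} [NormedAddCommGroup E] [InnerProductSpace ℝ E]

/-- `ψ` is a local defining function, with values in `ℝ^k`, for `M` at `x`: it is smooth on an open
neighbourhood `U` of `x`, its zero set in `U` is `M ∩ U`, and `Dψ(x)` has rank `k`. -/
def IsLocalDefiningFunction (M : Set E) (x : E) (k : ℕ) (ψ : E → EuclideanSpace ℝ (Fin k)) : Prop :=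
  ∃ U : Set E, IsOpen U ∧ x ∈ U ∧ ContDiffOn ℝ ∞ ψ U ∧ (∀ z ∈ U, ψ z = 0 ↔ z ∈ M) ∧
    Module.finrank ℝ (LinearMap.range (fderiv ℝ ψ x).toLinearMap) = k

/-- Embedded submanifolds of a Euclidean space: nonempty, and either open or locally cut out
by `k ≥ 1` independent smooth equations (the same `k` at every point). -/
def IsEmbeddedSubmanifold (M : Set E) : Prop :=
  M.Nonempty ∧
    (IsOpen M ∨
      ∃ k : ℕ, 1 ≤ k ∧ ∀ x ∈ M, ∃ ψ : E → EuclideanSpace ℝ (Fin k),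
        IsLocalDefiningFunction M x k ψ)

/-- The tangent space `T_x M = ker Dψ(x)`, for `ψ` a local defining function of `M` at `x`. The
kernel is the same for all of them, and the intersection over all of them is taken to avoid a
choice. When `M` is open there is none with `k ≥ 1`, and this is the whole space. -/
def tangentSpaceAt (M : Set E) (x : E) : Submodule ℝ E :=
  sInf {K | ∃ (k : ℕ) (ψ : E → EuclideanSpace ℝ (Fin k)),
    IsLocalDefiningFunction M x k ψ ∧ K = LinearMap.ker (fderiv ℝ ψ x).toLinearMap}

/-- The tangent bundle of `M`, as a subset of `E × E`. -/
def tangentBundleSet (M : Set E) : Set (E × E) :=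
  {p | p.1 ∈ M ∧ p.2 ∈ tangentSpaceAt M p.1}

/-- `R x v` stands for `R_x(v)`: a smooth map from the tangent bundle to `M` with `R_x(0) = x` and
`DR_x(0)[v] = v`. Values of `R` off the tangent bundle are irrelevant. (For a map on a submanifold,
`ContDiffOn ℝ ∞` on it is the same as smoothness in the sense of submanifolds.) -/
structure IsRetraction (M : Set E) (R : E → E → E) : Prop where
  smooth : ContDiffOn ℝ ∞ (fun p : E × E => R p.1 p.2) (tangentBundleSet M)
  maps_to : ∀ x ∈ M, ∀ v ∈ tangentSpaceAt M x, R x v ∈ M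
  at_zero : ∀ x ∈ M, R x 0 = x
  deriv_zero : ∀ x ∈ M, ∀ v ∈ tangentSpaceAt M x, HasDerivAt (fun t : ℝ => R x (t • v)) v 0

/-- `M₁, M₂ > 0` bound the zeroth and first order error of the retraction on the whole of `TM`. -/
def RetractionBounds (M : Set E) (R : E → E → E) (M₁ M₂ : ℝ) : Prop :=
  0 < M₁ ∧ 0 < M₂ ∧ ∀ x ∈ M, ∀ v ∈ tangentSpaceAt M x,
    ‖R x v - x‖ ≤ M₁ * ‖v‖ ∧ ‖R x v - (x + v)‖ ≤ M₂ * ‖v‖ ^ 2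

/-- Subdifferential of a real-valued convex function. -/
def subdiff (φ : E → ℝ) (x : E) : Set E :=
  {z | ∀ w, φ x + ⟪z, w - x⟫_ℝ ≤ φ w}

/-- Normal cone of a convex set `C` at a point `y ∈ C`. -/
def normalCone (C : Set E) (y : E) : Set E :=
  {z | ∀ w ∈ C, ⟪z, w - y⟫_ℝ ≤ 0}

/-- The minimizer of `φ` over `C` (only used where there is exactly one). -/
def argminOn (C : Set E) (φ : E → ℝ) : E :=
  Classical.epsilon fun u => u ∈ C ∧ IsMinOn φ C u

/-- The maximizer of `φ` over `C` (only used where there is exactly one). -/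
def argmaxOn (C : Set E) (φ : E → ℝ) : E :=
  Classical.epsilon fun u => u ∈ C ∧ IsMaxOn φ C u

end Geometry

/-- Data of `min_{x ∈ M} max_{y ∈ S} F(x,y) = f(x,y) + h(x) - g(y)`. -/
structure Problem (E₁ E₂ : Type*) where
  M : Set E₁
  S : Set E₂
  f : E₁ → E₂ → ℝ
  h : E₁ → ℝ
  g : E₂ → ℝ

/-- Parameters of the algorithm. -/
structure Params where
  c₁ : ℝ
  η : ℝ
  κ : ℝ
  ρ : ℝ
  lmin : ℝ
  lmax : ℝ

/-- The admissible range of the parameters. -/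
structure Params.Admissible (A : Params) (Ly : ℝ) : Prop where
  c₁_pos : 0 < A.c₁
  c₁_lt : A.c₁ < 1
  η_pos : 0 < A.η
  η_lt : A.η < 1
  κ_gt : 15 < A.κ
  ρ_pos : 0 < A.ρ
  ρ_le : A.ρ ≤ (1 - 2 * (A.κ + 1) ^ (-(1 / 4) : ℝ)) / Ly
  lmin_pos : 0 < A.lmin
  lmin_lt : A.lmin < A.lmax

/-- `γ_k = 2 / (ρ (k + κ + 2)^{1/4})`, for integers `k ≥ -1`. -/
def Params.γ (A : Params) (k : ℤ) : ℝ :=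
  2 / (A.ρ * ((k : ℝ) + A.κ + 2) ^ (1 / 4 : ℝ))

/-- `β_k = l_k / γ_k²`. -/
def Params.β (A : Params) (l : ℕ → ℝ) (k : ℕ) : ℝ :=
  l k / A.γ k ^ 2

namespace Problem

variable {E₁ E₂ : Type*} [NormedAddCommGroup E₁] [InnerProductSpace ℝ E₁] [FiniteDimensional ℝ E₁]
  [NormedAddCommGroup E₂] [InnerProductSpace ℝ E₂] [FiniteDimensional ℝ E₂]

/-- The objective `F`. -/
def F (P : Problem E₁ E₂) (x : E₁) (y : E₂) : ℝ := P.f x y + P.h x - P.g y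

/-- The partial gradient `∇_x f(x,y)`. -/
def gradX (P : Problem E₁ E₂) (x : E₁) (y : E₂) : E₁ := gradient (fun x' => P.f x' y) x

/-- The partial gradient `∇_y f(x,y)`. -/
def gradY (P : Problem E₁ E₂) (x : E₁) (y : E₂) : E₂ := gradient (fun y' => P.f x y') y

/-- `∇_x f(·,y)` is `L`-Lipschitz on `X`, for every `y ∈ S`. -/
def LipschitzGradX (P : Problem E₁ E₂) (X : Set E₁) (L : ℝ) : Prop :=
  ∀ x₁ ∈ X, ∀ x₂ ∈ X, ∀ y ∈ P.S, ‖P.gradX x₁ y - P.gradX x₂ y‖ ≤ L * ‖x₁ - x₂‖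

/-- `∇_y f` is `L`-Lipschitz on `X × S`, for the Euclidean norm of the product. -/
def LipschitzGradY (P : Problem E₁ E₂) (X : Set E₁) (L : ℝ) : Prop :=
  ∀ x₁ ∈ X, ∀ x₂ ∈ X, ∀ y₁ ∈ P.S, ∀ y₂ ∈ P.S,
    ‖P.gradY x₁ y₁ - P.gradY x₂ y₂‖ ^ 2 ≤ L ^ 2 * (‖x₁ - x₂‖ ^ 2 + ‖y₁ - y₂‖ ^ 2)

/-- The standing assumptions on the problem, with the constants `L_x`, `L_y`, `L_h`. -/
structure Standing (P : Problem E₁ E₂) (Lx Ly Lh : ℝ) : Prop where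
  submanifold : IsEmbeddedSubmanifold P.M
  compact_M : IsCompact P.M
  compact_S : IsCompact P.S
  convex_S : Convex ℝ P.S
  f_C1 : ContDiff ℝ 1 (fun p : E₁ × E₂ => P.f p.1 p.2)
  f_concave : ∀ x, ConcaveOn ℝ Set.univ (P.f x)
  h_convex : ConvexOn ℝ Set.univ P.h
  g_convex : ConvexOn ℝ Set.univ P.g
  Lx_pos : 0 < Lx
  Ly_pos : 0 < Ly
  lip_x : P.LipschitzGradX (convexHull ℝ P.M) Lx
  lip_y : P.LipschitzGradY P.M Ly
  lip_h : ∀ x₁ x₂, |P.h x₁ - P.h x₂| ≤ Lh * ‖x₁ - x₂‖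
  Lh_nonneg : 0 ≤ Lh

/-- `σ_y = sup_{y ∈ S} ‖y‖`. -/
def σy (P : Problem E₁ E₂) : ℝ := sSup ((fun y => ‖y‖) '' P.S)

/-- `G = sup {‖∇_x f(x,y)‖ : x ∈ M, y ∈ S}`. -/
def gradBound (P : Problem E₁ E₂) : ℝ :=
  sSup ((fun p : E₁ × E₂ => ‖P.gradX p.1 p.2‖) '' (P.M ×ˢ P.S))

/-! ### Stationarity -/

/-- The minimizer over `v ∈ T_x M` of `⟨∇_x f(x,y), v⟩ + h(x + v) + (β/2) ‖v‖²`. -/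
def proxDir (P : Problem E₁ E₂) (β : ℝ) (x : E₁) (y : E₂) : E₁ :=
  argminOn (tangentSpaceAt P.M x : Set E₁)
    (fun v => ⟪P.gradX x y, v⟫_ℝ + P.h (x + v) + β / 2 * ‖v‖ ^ 2)

/-- `∇_y f(x,y) - ∂g(y) - N_y S`. -/
def dualResidual (P : Problem E₁ E₂) (x : E₁) (y : E₂) : Set E₂ :=
  {z | ∃ a ∈ subdiff P.g y, ∃ b ∈ normalCone P.S y, z = P.gradY x y - a - b}

/-- The game-stationarity measure
`max {‖β u‖, dist(0, ∇_y f(x,y) - ∂g(y) - N_y S)}`, where `u` is `proxDir`; the distance to the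
empty set is `∞`. -/
def gameMeasure (P : Problem E₁ E₂) (β : ℝ) (x : E₁) (y : E₂) : ENNReal :=
  max (ENNReal.ofReal ‖β • P.proxDir β x y‖) (Metric.infEDist 0 (P.dualResidual x y))

/-- `ε`-game-stationary points. -/
def IsGameStationary (P : Problem E₁ E₂) (ε : ℝ) (x : E₁) (y : E₂) : Prop :=
  x ∈ P.M ∧ y ∈ P.S ∧ ∃ β : ℝ, 0 < β ∧ P.gameMeasure β x y ≤ ENNReal.ofReal ε

/-- The value function `Φ(x) = max_{y ∈ S} f(x,y) - g(y)`. -/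
def Φ (P : Problem E₁ E₂) (x : E₁) : ℝ := sSup ((fun y => P.f x y - P.g y) '' P.S)

/-- The approximate subdifferential `∂_ε Φ(x)` of the `L_x`-weakly convex function `Φ`. -/
def epsSubdiffΦ (P : Problem E₁ E₂) (Lx ε : ℝ) (x : E₁) : Set E₁ :=
  {z | ∀ w, P.Φ x + ⟪z, w - x⟫_ℝ - ε ≤ P.Φ w + Lx / 2 * ‖w - x‖ ^ 2}

/-- `∂_ε Φ(x + u) + ∂h(x + u) + N_x M`, where `N_x M` is the orthogonal complement of `T_x M`. -/
def primalResidual (P : Problem E₁ E₂) (Lx ε : ℝ) (x u : E₁) : Set E₁ :=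
  {z | ∃ a ∈ P.epsSubdiffΦ Lx ε (x + u), ∃ b ∈ subdiff P.h (x + u),
    ∃ n ∈ (tangentSpaceAt P.M x)ᗮ, z = a + b + n}

/-- `ε`-optimization-stationary points; the distance to the empty set is `∞`. -/
def IsOptStationary (P : Problem E₁ E₂) (Lx ε : ℝ) (x : E₁) : Prop :=
  x ∈ P.M ∧ ∃ u : E₁, ‖u‖ < ε ∧
    Metric.infEDist 0 (P.primalResidual Lx ε x u) < ENNReal.ofReal ε

/-! ### The algorithm -/

/-- `ŷ_k(x)`, the proximal gradient ascent step from `y_k = yk`. -/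
def yhat (P : Problem E₁ E₂) (A : Params) (k : ℤ) (yk : E₂) (x : E₁) : E₂ :=
  argmaxOn P.S (fun y => ⟪P.gradY x yk - A.γ k • yk, y - yk⟫_ℝ
    - 1 / (2 * A.ρ) * ‖y - yk‖ ^ 2 - P.g y)

/-- The regularized objective `F_k(x,y) = F(x,y) - (γ_{k-1}/2) ‖y‖²`. -/
def Freg (P : Problem E₁ E₂) (A : Params) (k : ℤ) (x : E₁) (y : E₂) : ℝ :=
  P.F x y - A.γ (k - 1) / 2 * ‖y‖ ^ 2

/-- `ℋ_k(y)`, where `yprev` is `y_{k-1}`. -/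
def calH (A : Params) (k : ℤ) (yprev y : E₂) : ℝ :=
  (4 / (A.ρ ^ 2 * A.γ k) - 4 / A.ρ) * ‖y - yprev‖ ^ 2
    + 4 / A.ρ * (1 - A.γ (k - 1) / A.γ k) * ‖y‖ ^ 2

/-- The potential `ℱ_k(x,y)`, where `yprev` is `y_{k-1}`. -/
def calF (P : Problem E₁ E₂) (A : Params) (k : ℤ) (yprev : E₂) (x : E₁) (y : E₂) : ℝ :=
  P.Freg A k x y + 1 / (2 * A.ρ) * ‖y - yprev‖ ^ 2
    + (4 / A.ρ * (A.γ (k - 1) / A.γ k) + A.γ (k - 1) / 2) * P.σy ^ 2 + calH A k yprev y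

/-- The trial point `x_k^j = R_{x_k}(η^j v_k)`. -/
def trial (P : Problem E₁ E₂) (R : E₁ → E₁ → E₁) (A : Params) (βk : ℝ) (xk : E₁) (yk : E₂)
    (j : ℕ) : E₁ :=
  R xk (A.η ^ j • P.proxDir βk xk yk)

/-- The line search test at iteration `k` with `j` backtracking steps:
`ℱ_{k+1}(x_k^j, ŷ_k(x_k^j)) ≤ ℱ_k(x_k,y_k) - c₁ η^j β_k ‖v_k‖² - ‖ŷ_k(x_k^j) - y_k‖² / (10 ρ)`. -/
def Accept (P : Problem E₁ E₂) (R : E₁ → E₁ → E₁) (A : Params) (k : ℤ) (βk : ℝ)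
    (yprev : E₂) (xk : E₁) (yk : E₂) (j : ℕ) : Prop :=
  P.calF A (k + 1) yk (P.trial R A βk xk yk j) (P.yhat A k yk (P.trial R A βk xk yk j))
    ≤ P.calF A k yprev xk yk - A.c₁ * A.η ^ j * βk * ‖P.proxDir βk xk yk‖ ^ 2
      - 1 / (10 * A.ρ) * ‖P.yhat A k yk (P.trial R A βk xk yk j) - yk‖ ^ 2

/-- The sequences `x_0, x_1, …` and `y_{-1}, y_0, y_1, …` are generated by the algorithm with the
step parameters `l_0, l_1, …` (`y k` for `k < -1` plays no role). -/
structure IsRun (P : Problem E₁ E₂) (R : E₁ → E₁ → E₁) (A : Params) (l : ℕ → ℝ)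
    (x : ℕ → E₁) (y : ℤ → E₂) : Prop where
  l_mem : ∀ k, l k ∈ Set.Icc A.lmin A.lmax
  x_zero_mem : x 0 ∈ P.M
  y_neg_one_mem : y (-1) ∈ P.S
  y_zero : y 0 = P.yhat A (-1) (y (-1)) (x 0)
  step : ∀ k : ℕ, ∃ j : ℕ,
    IsLeast {i | P.Accept R A k (A.β l k) (y ((k : ℤ) - 1)) (x k) (y k) i} j ∧
    x (k + 1) = P.trial R A (A.β l k) (x k) (y k) j ∧
    y ((k : ℤ) + 1) = P.yhat A k (y k) (x (k + 1))

/-- The indices `k` with `𝒢^{β_k}(x_k,y_k) < ε`. -/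
def goodIndices (P : Problem E₁ E₂) (A : Params) (l : ℕ → ℝ) (x : ℕ → E₁) (y : ℤ → E₂)
    (ε : ℝ) : Set ℕ :=
  {k | P.gameMeasure (A.β l k) (x k) (y k) < ENNReal.ofReal ε}

/-- `T(ε) = min {k : 𝒢^{β_k}(x_k,y_k) < ε}` (the set is shown to be nonempty). -/
def T (P : Problem E₁ E₂) (A : Params) (l : ℕ → ℝ) (x : ℕ → E₁) (y : ℤ → E₂) (ε : ℝ) : ℕ :=
  sInf (P.goodIndices A l x y ε)

/-! ### The constants of the bound -/

/-- `b₁ = M₂ (L_h + G) + M₁² (L_x + ρ L_y²) / 2`. -/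
def b₁ (P : Problem E₁ E₂) (A : Params) (Lx Ly Lh M₁ M₂ : ℝ) : ℝ :=
  M₂ * (Lh + P.gradBound) + M₁ ^ 2 * (Lx + A.ρ * Ly ^ 2) / 2

/-- `J₂ = max {⌈log_η (ρ (1 - c₁) l_min / (ρ b₁ γ_{-1}² + 8 L_y² M₁²))⌉, 0}`. -/
def J₂ (P : Problem E₁ E₂) (A : Params) (Lx Ly Lh M₁ M₂ : ℝ) : ℕ :=
  ⌈Real.logb A.η (A.ρ * (1 - A.c₁) * A.lmin /
    (A.ρ * P.b₁ A Lx Ly Lh M₁ M₂ * A.γ (-1) ^ 2 + 8 * Ly ^ 2 * M₁ ^ 2))⌉₊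

/-- `C₁ = min {4 c₁ η^{J₂} / (l_max ρ²), ρ (κ + 2)^{1/2} / 10}`. -/
def C₁ (P : Problem E₁ E₂) (A : Params) (Lx Ly Lh M₁ M₂ : ℝ) : ℝ :=
  min (4 * A.c₁ * A.η ^ P.J₂ A Lx Ly Lh M₁ M₂ / (A.lmax * A.ρ ^ 2))
    (A.ρ * (A.κ + 2) ^ (1 / 2 : ℝ) / 10)

/-- The upper constant `ℱ̄`. -/
def Fupper (P : Problem E₁ E₂) (A : Params) : ℝ :=
  sSup ((fun p : E₁ × E₂ => P.F p.1 p.2 +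
    (6 / A.ρ + 16 / (A.ρ ^ 2 * A.γ 0) + 4 * A.γ (-1) / (A.ρ * A.γ 0) + A.γ (-1) / 2) * P.σy ^ 2) ''
      (P.M ×ˢ P.S))

/-- The lower constant `ℱ̲`. -/
def Flower (P : Problem E₁ E₂) (A : Params) : ℝ :=
  sInf ((fun p : E₁ × E₂ => P.F p.1 p.2 - (A.γ (-1) / 2 + 24 / A.ρ) * P.σy ^ 2) ''
    (P.M ×ˢ P.S))

end Problem

end ManifoldMinimax

end

/-!
The proof follows a potential along the iterates. One iteration `k ↦ k + 1` moves `x` along the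
retraction of a fraction `α = η ^ j` of the tangential proximal step `v`, and then makes one
proximal ascent step in `y`.

* *Primal part.* The errors `M₁ ‖v‖` and `M₂ ‖v‖²` of the retraction hold on all of `TM`: near the
  zero section they come from Taylor's formula along `t ↦ R_x(t v)` and compactness of `M`, and for
  long tangent vectors from the diameter of `M` (`IsRetraction.exists_bounds`). Together with the
  descent lemma and the optimality of `v` they give
  `F(x⁺, y) - F(x, y) ≤ -α β ‖v‖² + O(α² ‖v‖²)` (`F_trial_sub_le`).

* *Dual part.* Let `Δ = y_k - y_{k-1}`, `Δ⁺ = y_{k+1} - y_k`. The variational inequalities of two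
  consecutive ascent steps, tested at each other's solution, give an ascent estimate for the
  regularized objective and a recursion for `‖Δ‖²` (`dual_step`). What makes both work is that the
  increment `Q` of the regularized gradient `∇_y f - γ ·` along `Δ` satisfies
  `⟨Q, Δ⁺⟩ ≤ ‖Δ⁺ - Δ‖² / (2ρ) - (γ/2) ‖Δ‖²` when `ρ (L_y + γ) ≤ 1`. This is a consequence of
  cocoercivity. Since `∇_y f` is Lipschitz only on `S`, which may have empty interior, cocoercivity
  is proved just in the direction of the second difference `Δ⁺ - Δ` of points of `S`
  (`inner_sq_le_second_difference`).

* *Potential.* Adding the recursion with weight `8 / (ρ γ_k)` to the ascent estimate makes the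
  potential decrease, up to the change of `∇_y f` caused by the move in `x` (`calF_sub_le`). The
  terms in `‖y‖²` that the varying `γ_k` leaves behind have a sign because `γ_k` and
  `γ_{k-1} / γ_k` decrease, and are absorbed by the multiples of `σ_y²` in the potential. Hence the
  line search stops after at most `J₂` steps (`accept_of_pow_le`).

* *Rate.* Summing up, the primal measure `‖β_k v_k‖` and the dual steps are square summable with
  weights `(k + κ + 2)^{-1/2}` (`run_weighted_sum_le`), while the dual residual exceeds a
  constant multiple of the dual step only by `γ_{k-1} σ_y` (`run_infEDist_le`). Averaging over all `k < N` and the Cauchy-Schwarz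
  inequality bound the number `N` of iterations with measure at least `ε` (`run_count_le`).

* *Optimization stationarity.* If `(x, y)` is nearly game stationary, then by concavity `y` nearly
  maximizes `f(x + v, ·) - g`, so `∇_x f(x + v, y)` is an approximate subgradient of `Φ` at `x + v`;
  the optimality condition of `v` supplies the subgradient of `h` and the normal vector
  (`exists_opt_bound`).
-/

namespace ManifoldMinimax

/-! ### Convex analysis in Euclidean spaces -/

section ConvexAnalysis

variable {E : Type*} [NormedAddCommGroup E] [InnerProductSpace ℝ E]

section Gradient

variable [CompleteSpace E]

lemma hasGradientAt_neg {f : E → ℝ} {g x : E} (h : HasGradientAt f g x) :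
    HasGradientAt (fun z => -f z) (-g) x := by
  rw [hasGradientAt_iff_hasFDerivAt, map_neg]
  exact h.hasFDerivAt.neg

lemma hasDerivAt_comp_line {f : E → ℝ} {G : E → E} (hf : ∀ z, HasGradientAt f (G z) z)
    (a d : E) (t : ℝ) :
    HasDerivAt (fun s : ℝ => f (a + s • d)) ⟪G (a + t • d), d⟫_ℝ t := by
  have h1 : HasDerivAt (fun s : ℝ => a + s • d) d t := by
    simpa using ((hasDerivAt_id t).smul_const d).const_add a
  have h2 := (hf (a + t • d)).hasFDerivAt.comp_hasDerivAt t h1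
  simpa [Function.comp_def] using h2

/-- The descent lemma along one segment: only the growth of the gradient on that segment enters. -/
lemma le_of_gradient_lipschitz_segment {f : E → ℝ} {G : E → E}
    (hf : ∀ z, HasGradientAt f (G z) z) {L : ℝ} {a b : E}
    (hL : ∀ t ∈ Set.Icc (0 : ℝ) 1, ‖G (a + t • (b - a)) - G a‖ ≤ L * (t * ‖b - a‖)) :
    f b ≤ f a + ⟪G a, b - a⟫_ℝ + L / 2 * ‖b - a‖ ^ 2 := by
  set d := b - a with hd
  let ψ : ℝ → ℝ := fun t => f (a + t • d) - t * ⟪G a, d⟫_ℝ - L / 2 * ‖d‖ ^ 2 * t ^ 2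
  have hψ : ∀ t, HasDerivAt ψ (⟪G (a + t • d), d⟫_ℝ - ⟪G a, d⟫_ℝ - L * ‖d‖ ^ 2 * t) t := by
    intro t
    have h := (((hasDerivAt_comp_line hf a d t).sub
      ((hasDerivAt_id t).mul_const ⟪G a, d⟫_ℝ)).sub
      ((hasDerivAt_pow 2 t).const_mul (L / 2 * ‖d‖ ^ 2)))
    refine HasDerivAt.congr_deriv h ?_
    push_cast
    ring
  have hanti : AntitoneOn ψ (Set.Icc 0 1) := by
    apply antitoneOn_of_deriv_nonpos (convex_Icc 0 1)
      (fun t _ => (hψ t).continuousAt.continuousWithinAt)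
      (fun t _ => (hψ t).differentiableAt.differentiableWithinAt)
    intro t ht
    rw [interior_Icc] at ht
    rw [(hψ t).deriv, ← inner_sub_left]
    have h1 := real_inner_le_norm (G (a + t • d) - G a) d
    have h2 := mul_le_mul_of_nonneg_right (hL t ⟨ht.1.le, ht.2.le⟩) (norm_nonneg d)
    nlinarith
  have h := hanti (Set.left_mem_Icc.2 zero_le_one) (Set.right_mem_Icc.2 zero_le_one) zero_le_one
  simp only [ψ, one_smul, zero_smul, add_zero, hd, add_sub_cancel] at h
  linarith

lemma ConvexOn.add_inner_gradient_le {f : E → ℝ} {G : E → E}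
    (hf : ∀ z, HasGradientAt f (G z) z) (hc : ConvexOn ℝ Set.univ f) (a w : E) :
    f a + ⟪G a, w - a⟫_ℝ ≤ f w := by
  have hline : ConvexOn ℝ Set.univ (fun s : ℝ => f (a + s • (w - a))) := by
    refine ⟨convex_univ, fun s _ t _ p q hp hq hpq => ?_⟩
    have h := hc.2 (Set.mem_univ (a + s • (w - a))) (Set.mem_univ (a + t • (w - a))) hp hq hpq
    have e : a + (p • s + q • t) • (w - a)
        = p • (a + s • (w - a)) + q • (a + t • (w - a)) := by
      have : a = (p + q) • a := by rw [hpq, one_smul]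
      nth_rewrite 1 [this]
      simp only [smul_add, add_smul, smul_smul, smul_eq_mul]
      abel
    simp only [e]
    exact h
  have hd := hasDerivAt_comp_line hf a (w - a) 0
  have h := hline.le_slope_of_hasDerivAt (Set.mem_univ 0) (Set.mem_univ 1) zero_lt_one hd
  simp only [slope_def_field, zero_smul, one_smul, add_zero, sub_zero, div_one,
    add_sub_cancel] at h
  linarith

/-- Half of the local cocoercivity estimate in the direction `D`: it comes from comparing the
upper quadratic bound at `b` and the tangent at `a` in the point `b + s • D`, for the best `s`. -/
lemma inner_sq_le_bregman {φ : E → ℝ} {G : E → E} (hφ : ∀ z, HasGradientAt φ (G z) z)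
    (hc : ConvexOn ℝ Set.univ φ) {S : Set E} (hS : Convex ℝ S) {L : ℝ} (hL : 0 < L)
    (hlip : ∀ z ∈ S, ∀ w ∈ S, ‖G z - G w‖ ≤ L * ‖z - w‖) {a b D : E} {δ : ℝ}
    (ha : a ∈ S) (hb : ∀ s : ℝ, |s| ≤ δ → b + s • D ∈ S) (hδ : 0 ≤ δ)
    (hab : ‖b - a‖ ≤ δ * ‖D‖) :
    ⟪G b - G a, D⟫_ℝ ^ 2 ≤ 2 * L * ‖D‖ ^ 2 * (φ b - φ a - ⟪G a, b - a⟫_ℝ) := by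
  rcases eq_or_ne D 0 with rfl | hD
  · simp
  have hDpos : 0 < ‖D‖ := norm_pos_iff.2 hD
  have hb0 : b ∈ S := by simpa using hb 0 (by simpa using hδ)
  set r := ⟪G b - G a, D⟫_ℝ with hr
  set s : ℝ := -r / (L * ‖D‖ ^ 2) with hs
  have habs : |s| ≤ δ := by
    rw [hs, abs_div, abs_neg, abs_of_pos (by positivity : 0 < L * ‖D‖ ^ 2),
      div_le_iff₀ (by positivity)]
    have h1 : |r| ≤ ‖G b - G a‖ * ‖D‖ := abs_real_inner_le_norm _ _
    have h2 : ‖G b - G a‖ ≤ L * (δ * ‖D‖) :=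
      (hlip b hb0 a ha).trans (mul_le_mul_of_nonneg_left hab hL.le)
    have h3 := mul_le_mul_of_nonneg_right h2 hDpos.le
    nlinarith
  have hw := hb s habs
  have hup := le_of_gradient_lipschitz_segment hφ (L := L) (a := b) (b := b + s • D) (by
    intro t ht
    have hmem : b + t • (b + s • D - b) ∈ S := by
      have := hS.add_smul_mem hb0 (y := b + s • D - b) (by simpa using hw) ht
      simpa using this
    have := hlip _ hmem b hb0
    rwa [add_sub_cancel_left b (t • _), norm_smul, Real.norm_of_nonneg ht.1] at this)
  have hlow := ConvexOn.add_inner_gradient_le hφ hc a (b + s • D)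
  simp only [add_sub_cancel_left, inner_smul_right, norm_smul, Real.norm_eq_abs, mul_pow,
    sq_abs] at hup
  have e1 : ⟪G a, b + s • D - a⟫_ℝ = ⟪G a, b - a⟫_ℝ + s * ⟪G a, D⟫_ℝ := by
    rw [show b + s • D - a = (b - a) + s • D by abel, inner_add_right, inner_smul_right]
  have e2 : r = ⟪G b, D⟫_ℝ - ⟪G a, D⟫_ℝ := by rw [hr, inner_sub_left]
  have key : -(s * r) - L / 2 * (s ^ 2 * ‖D‖ ^ 2) ≤ φ b - φ a - ⟪G a, b - a⟫_ℝ := by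
    rw [e2]; rw [e1] at hlow; linarith
  have e3 : -(s * r) - L / 2 * (s ^ 2 * ‖D‖ ^ 2) = r ^ 2 / (2 * L * ‖D‖ ^ 2) := by
    rw [hs]; field_simp; ring
  rw [e3, div_le_iff₀ (by positivity)] at key
  linarith

/-- Directional cocoercivity of the gradient between two points `a`, `b` of a convex set `S`, when
the segment from `a` to `b` can be moved a little within `S` along `±D`. The segment is cut into
pieces that are short compared with the room for moving. -/
lemma inner_sq_le_of_room {φ : E → ℝ} {G : E → E} (hφ : ∀ z, HasGradientAt φ (G z) z)
    (hc : ConvexOn ℝ Set.univ φ) {S : Set E} (hS : Convex ℝ S) {L : ℝ} (hL : 0 < L)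
    (hlip : ∀ z ∈ S, ∀ w ∈ S, ‖G z - G w‖ ≤ L * ‖z - w‖) {a b D : E} {δ : ℝ} (hδ : 0 < δ)
    (hroom : ∀ t ∈ Set.Icc (0 : ℝ) 1, ∀ s : ℝ, |s| ≤ δ → a + t • (b - a) + s • D ∈ S) :
    ⟪G b - G a, D⟫_ℝ ^ 2 ≤ L * ‖D‖ ^ 2 * ⟪G b - G a, b - a⟫_ℝ := by
  rcases eq_or_ne D 0 with rfl | hD
  · simp
  have hDpos : 0 < ‖D‖ := norm_pos_iff.2 hD
  obtain ⟨N, hN⟩ := exists_nat_gt (‖b - a‖ / (δ * ‖D‖))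
  have hNpos : (0 : ℝ) < N := lt_of_le_of_lt (by positivity) hN
  let p : ℕ → E := fun i => a + ((i : ℝ) / N) • (b - a)
  have hstep : ∀ i, p (i + 1) - p i = (1 / (N : ℝ)) • (b - a) := by
    intro i
    simp only [p, add_sub_add_left_eq_sub, ← sub_smul]
    congr 1
    push_cast
    ring
  have hlen : ∀ i, ‖p (i + 1) - p i‖ ≤ δ * ‖D‖ := by
    intro i
    rw [hstep, norm_smul, Real.norm_of_nonneg (by positivity), one_div, inv_mul_le_iff₀ hNpos]
    rw [div_lt_iff₀ (by positivity)] at hN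
    linarith
  have hp : ∀ i ≤ N, ∀ s : ℝ, |s| ≤ δ → p i + s • D ∈ S := fun i hi s hs =>
    hroom _ ⟨by positivity, by rw [div_le_one hNpos]; exact_mod_cast hi⟩ s hs
  have hpS : ∀ i ≤ N, p i ∈ S := fun i hi => by simpa using hp i hi 0 (by simpa using hδ.le)
  have hpiece : ∀ i ∈ Finset.range N, ⟪G (p (i + 1)) - G (p i), D⟫_ℝ ^ 2
      ≤ L * ‖D‖ ^ 2 * (1 / (N : ℝ) * ⟪G (p (i + 1)) - G (p i), b - a⟫_ℝ) := by
    intro i hi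
    rw [Finset.mem_range] at hi
    have h1 := inner_sq_le_bregman hφ hc hS hL hlip (hpS i hi.le) (hp (i + 1) hi) hδ.le (hlen i)
    have h2 := inner_sq_le_bregman hφ hc hS hL hlip (hpS (i + 1) hi) (hp i hi.le) hδ.le
      (by rw [norm_sub_rev]; exact hlen i)
    have e1 : ⟪G (p i) - G (p (i + 1)), D⟫_ℝ ^ 2 = ⟪G (p (i + 1)) - G (p i), D⟫_ℝ ^ 2 := by
      rw [← neg_sub, inner_neg_left, neg_sq]
    have e2 : 1 / (N : ℝ) * ⟪G (p (i + 1)) - G (p i), b - a⟫_ℝ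
        = -⟪G (p i), p (i + 1) - p i⟫_ℝ - ⟪G (p (i + 1)), p i - p (i + 1)⟫_ℝ := by
      rw [← neg_sub (p (i + 1)) (p i), inner_neg_right, hstep, inner_smul_right, inner_smul_right,
        inner_sub_left]
      ring
    rw [e1] at h2
    rw [e2]
    nlinarith
  have hsum : ∑ i ∈ Finset.range N, (G (p (i + 1)) - G (p i)) = G b - G a := by
    rw [Finset.sum_range_sub (fun i => G (p i))]
    have e1 : p N = b := by simp [p, div_self hNpos.ne']
    have e0 : p 0 = a := by simp [p]
    simp only [e1, e0]
  have hsumD : ∀ w, ∑ i ∈ Finset.range N, ⟪G (p (i + 1)) - G (p i), w⟫_ℝ = ⟪G b - G a, w⟫_ℝ := by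
    intro w
    rw [← sum_inner, hsum]
  calc ⟪G b - G a, D⟫_ℝ ^ 2
      = (∑ i ∈ Finset.range N, ⟪G (p (i + 1)) - G (p i), D⟫_ℝ) ^ 2 := by rw [hsumD]
    _ ≤ N * ∑ i ∈ Finset.range N, ⟪G (p (i + 1)) - G (p i), D⟫_ℝ ^ 2 := by
        simpa using sq_sum_le_card_mul_sum_sq (s := Finset.range N)
          (f := fun i => ⟪G (p (i + 1)) - G (p i), D⟫_ℝ)
    _ ≤ N * ∑ i ∈ Finset.range N,
          L * ‖D‖ ^ 2 * (1 / (N : ℝ) * ⟪G (p (i + 1)) - G (p i), b - a⟫_ℝ) :=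
        mul_le_mul_of_nonneg_left (Finset.sum_le_sum hpiece) hNpos.le
    _ = L * ‖D‖ ^ 2 * ⟪G b - G a, b - a⟫_ℝ := by
        rw [← Finset.mul_sum, ← Finset.mul_sum, hsumD]
        field_simp

/-- Cocoercivity on a convex set `S`, in the direction of a second difference `u - 2 b + a` of
points of `S`. Since `S` may have empty interior and the gradient is Lipschitz on `S` only, full
cocoercivity is not available. The triangle `a b u` is shrunk towards its centroid, which makes
room along the direction, and the estimate passes to the limit. -/
lemma inner_sq_le_second_difference {φ : E → ℝ} {G : E → E}
    (hφ : ∀ z, HasGradientAt φ (G z) z) (hG : Continuous G)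
    (hc : ConvexOn ℝ Set.univ φ) {S : Set E} (hS : Convex ℝ S) {L : ℝ} (hL : 0 < L)
    (hlip : ∀ z ∈ S, ∀ w ∈ S, ‖G z - G w‖ ≤ L * ‖z - w‖) {a b u : E}
    (ha : a ∈ S) (hb : b ∈ S) (hu : u ∈ S) :
    ⟪G b - G a, (u - b) - (b - a)⟫_ℝ ^ 2
      ≤ L * ‖(u - b) - (b - a)‖ ^ 2 * ⟪G b - G a, b - a⟫_ℝ := by
  set D := (u - b) - (b - a) with hD
  let c : E := (1 / 3 : ℝ) • a + (1 / 3 : ℝ) • b + (1 / 3 : ℝ) • u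
  let a' : ℝ → E := fun e => (1 - e) • a + e • c
  let b' : ℝ → E := fun e => (1 - e) • b + e • c
  have ha' : Continuous a' := by fun_prop
  have hb' : Continuous b' := by fun_prop
  have hcomb : ∀ p q r : ℝ, 0 ≤ p → 0 ≤ q → 0 ≤ r → p + q + r = 1 →
      p • a + q • b + r • u ∈ S := by
    intro p q r hp hq hr hpqr
    have h := hS.sum_mem (t := Finset.univ) (w := ![p, q, r]) (z := ![a, b, u])
      (by intro i _; fin_cases i <;> simpa) (by simp [Fin.sum_univ_three, hpqr])
      (by intro i _; fin_cases i <;> simpa)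
    simpa [Fin.sum_univ_three] using h
  have hpos : ∀ e ∈ Set.Ioc (0 : ℝ) 1, ⟪G (b' e) - G (a' e), D⟫_ℝ ^ 2
      ≤ L * ‖D‖ ^ 2 * ⟪G (b' e) - G (a' e), b' e - a' e⟫_ℝ := by
    intro e he
    refine inner_sq_le_of_room hφ hc hS hL hlip (δ := e / 6) (by linarith [he.1]) ?_
    intro t ht s hs
    rw [abs_le] at hs
    have h1 : 0 ≤ (1 - e) * (1 - t) := mul_nonneg (by linarith [he.2]) (by linarith [ht.2])
    have h2 : 0 ≤ (1 - e) * t := mul_nonneg (by linarith [he.2]) ht.1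
    have h := hcomb ((1 - e) * (1 - t) + e / 3 + s) ((1 - e) * t + e / 3 - 2 * s) (e / 3 + s)
      (by linarith) (by linarith) (by linarith) (by ring)
    convert h using 1
    simp only [a', b', c, hD]
    module
  have hcont1 : Continuous fun e : ℝ => ⟪G (b' e) - G (a' e), D⟫_ℝ ^ 2 := by fun_prop
  have hcont2 : Continuous fun e : ℝ =>
      L * ‖D‖ ^ 2 * ⟪G (b' e) - G (a' e), b' e - a' e⟫_ℝ := by fun_prop
  have hlim := le_of_tendsto_of_tendsto (b := nhdsWithin (0 : ℝ) (Set.Ioi 0))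
    (hcont1.continuousWithinAt (x := 0)) (hcont2.continuousWithinAt (x := 0)) (by
      filter_upwards [Ioc_mem_nhdsGT (zero_lt_one' ℝ)] with e he using hpos e he)
  simpa [a', b'] using hlim

end Gradient

/-- First order optimality of a proximal point: the quadratic term may be linearized. -/
lemma le_add_inner_of_isMinOn_prox {φ : E → ℝ} {C : Set E} (hC : Convex ℝ C)
    (hφ : ConvexOn ℝ Set.univ φ) {c : ℝ} {y₀ y : E} (hy : y ∈ C)
    (hmin : IsMinOn (fun w => φ w + c / 2 * ‖w - y₀‖ ^ 2) C y) {w : E} (hw : w ∈ C) :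
    φ y ≤ φ w + c * ⟪y - y₀, w - y⟫_ℝ := by
  have hlin : ∀ t ∈ Set.Ioc (0 : ℝ) 1,
      φ y ≤ φ w + c * ⟪y - y₀, w - y⟫_ℝ + t * (c / 2 * ‖w - y‖ ^ 2) := by
    intro t ht
    have hmem : y + t • (w - y) ∈ C :=
      hC.add_smul_mem hy (by simpa using hw) ⟨ht.1.le, ht.2⟩
    have h1 := isMinOn_iff.1 hmin _ hmem
    have h2 := hφ.2 (Set.mem_univ y) (Set.mem_univ w) (sub_nonneg.2 ht.2) ht.1.le (by ring)
    rw [show (1 - t) • y + t • w = y + t • (w - y) by module] at h2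
    have e : ‖y + t • (w - y) - y₀‖ ^ 2
        = ‖y - y₀‖ ^ 2 + 2 * t * ⟪y - y₀, w - y⟫_ℝ + t ^ 2 * ‖w - y‖ ^ 2 := by
      rw [show y + t • (w - y) - y₀ = (y - y₀) + t • (w - y) by abel, norm_add_sq_real,
        inner_smul_right, norm_smul, mul_pow, Real.norm_eq_abs, sq_abs]
      ring
    simp only [e, smul_eq_mul] at h1 h2
    have h3 : t * φ y ≤ t * (φ w + c * ⟪y - y₀, w - y⟫_ℝ + t * (c / 2 * ‖w - y‖ ^ 2)) := by
      nlinarith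
    exact le_of_mul_le_mul_left h3 ht.1
  have hcont : Continuous fun t : ℝ =>
      φ w + c * ⟪y - y₀, w - y⟫_ℝ + t * (c / 2 * ‖w - y‖ ^ 2) := by fun_prop
  have hlim := ge_of_tendsto (b := φ y)
    (hcont.continuousWithinAt (x := 0) (s := Set.Ioi 0)).tendsto (by
      filter_upwards [Ioc_mem_nhdsGT (zero_lt_one' ℝ)] with t ht using hlin t ht)
  simpa using hlim

variable [FiniteDimensional ℝ E]

lemma continuous_of_convexOn_univ {φ : E → ℝ} (hφ : ConvexOn ℝ Set.univ φ) : Continuous φ :=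
  continuousOn_univ.1 (hφ.continuousOn isOpen_univ)

/-- Fermat's rule for a convex function on a convex set, by separating its strict epigraph from
the part of the cylinder over `C` below the minimum. -/
lemma exists_subgradient_of_isMinOn {φ : E → ℝ} (hφ : ConvexOn ℝ Set.univ φ) {C : Set E}
    (hC : Convex ℝ C) {y : E} (hy : y ∈ C) (hmin : ∀ w ∈ C, φ y ≤ φ w) :
    ∃ a ∈ subdiff φ y, -a ∈ normalCone C y := by
  have hcont := continuous_of_convexOn_univ hφ
  have hopen : IsOpen {p : E × ℝ | p.1 ∈ Set.univ ∧ φ p.1 < p.2} := by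
    simpa using isOpen_lt (hcont.comp continuous_fst) continuous_snd
  obtain ⟨ℓ, u, hA, hB⟩ := geometric_hahn_banach_open hφ.convex_strict_epigraph hopen
    (hC.prod (convex_Iic (φ y))) (Set.disjoint_left.2 (by
      rintro ⟨w, t⟩ ⟨-, hlt⟩ ⟨hw, ht⟩
      exact absurd (hmin w hw) (not_le.2 (lt_of_lt_of_le hlt ht))))
  set τ := ℓ (0, 1) with hτ
  have hsplit : ∀ w t, ℓ (w, t) = ℓ (w, 0) + τ * t := by
    intro w t
    have : (w, t) = (w, (0 : ℝ)) + t • ((0 : E), (1 : ℝ)) := by simp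
    rw [this, map_add, map_smul, smul_eq_mul, mul_comm]
  have hA' : ∀ w, ℓ (w, 0) + τ * φ w ≤ u := by
    intro w
    have hc : Continuous fun e : ℝ => ℓ (w, 0) + τ * (φ w + e) := by fun_prop
    have := le_of_tendsto (b := u) (hc.continuousWithinAt (x := 0) (s := Set.Ioi 0)).tendsto (by
      filter_upwards [self_mem_nhdsWithin] with e he
      rw [← hsplit]
      exact (hA (w, φ w + e) ⟨Set.mem_univ _, lt_add_of_pos_right _ he⟩).le)
    simpa using this
  have hB' : ∀ w ∈ C, u ≤ ℓ (w, 0) + τ * φ y := by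
    intro w hw
    rw [← hsplit]
    exact hB _ ⟨hw, le_refl (φ y)⟩
  have hτneg : τ < 0 := by
    have h1 := hA (y, φ y + 1) ⟨Set.mem_univ _, lt_add_one _⟩
    have h2 := hB' y hy
    rw [hsplit] at h1
    linarith
  let m : E →L[ℝ] ℝ := ℓ.comp (ContinuousLinearMap.inl ℝ E ℝ)
  have hm : ∀ w, m w = ℓ (w, 0) := fun w => rfl
  let z := (InnerProductSpace.toDual ℝ E).symm m
  have hz : ∀ w, ⟪z, w⟫_ℝ = m w := fun w => InnerProductSpace.toDual_symm_apply
  refine ⟨(-τ)⁻¹ • z, fun w => ?_, fun w hw => ?_⟩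
  · rw [real_inner_smul_left, hz, map_sub, hm, hm]
    have h1 := hA' w
    have h2 := hB' y hy
    have : (-τ)⁻¹ * (ℓ (w, 0) - ℓ (y, 0)) ≤ φ w - φ y := by
      rw [inv_mul_le_iff₀ (neg_pos.2 hτneg)]
      linarith
    linarith
  · rw [inner_neg_left, real_inner_smul_left, hz, map_sub, hm, hm, neg_nonpos]
    have h1 := hA' y
    have h2 := hB' w hw
    have h3 : 0 < (-τ)⁻¹ := inv_pos.2 (neg_pos.2 hτneg)
    exact mul_nonneg h3.le (by linarith)

end ConvexAnalysis

/-! ### Global error bounds of a retraction -/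

section Retraction

variable {E : Type*} [NormedAddCommGroup E] [InnerProductSpace ℝ E]

/-- Second order Taylor expansion of `t ↦ R z (t • v)`, uniformly for base points `z` near `x`.
The path `t ↦ (z, t • v)` stays inside the tangent bundle, so the derivatives within the
tangent bundle that smoothness provides are enough. -/
lemma IsRetraction.exists_local_bound {M : Set E} {R : E → E → E} (hR : IsRetraction M R)
    {x : E} (hx : x ∈ M) :
    ∃ r > 0, ∃ C ≥ 0, ∀ z ∈ M, ‖z - x‖ < r → ∀ v ∈ tangentSpaceAt M z, ‖v‖ < r →
      ‖R z v - (z + v)‖ ≤ C * ‖v‖ ^ 2 := by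
  have hx0 : ((x, 0) : E × E) ∈ tangentBundleSet M := ⟨hx, Submodule.zero_mem _⟩
  have h2 : ContDiffWithinAt ℝ (1 + 1) (fun p : E × E => R p.1 p.2) (tangentBundleSet M) (x, 0) :=
    (hR.smooth _ hx0).of_le (by
      rw [one_add_one_eq_two]
      exact WithTop.coe_le_coe.2 le_top)
  obtain ⟨u, hu, -, f', hf', hf'1⟩ :=
    (contDiffWithinAt_succ_iff_hasFDerivWithinAt (by simp)).1 h2
  rw [Set.insert_eq_of_mem hx0] at hu
  have hxu : ((x, 0) : E × E) ∈ u := mem_of_mem_nhdsWithin hx0 hu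
  rw [show (1 : WithTop ℕ∞) = 0 + 1 by simp] at hf'1
  obtain ⟨u₂, hu₂, -, f'', hf'', hf''0⟩ :=
    (contDiffWithinAt_succ_iff_hasFDerivWithinAt (by simp)).1 hf'1
  rw [Set.insert_eq_of_mem hxu] at hu₂
  have hxu₂ : ((x, 0) : E × E) ∈ u₂ := mem_of_mem_nhdsWithin hxu hu₂
  have hbdd : ∀ᶠ p in nhdsWithin ((x, 0) : E × E) u₂, ‖f'' p‖ < ‖f'' (x, 0)‖ + 1 :=
    hf''0.continuousWithinAt.norm.eventually_lt_const (lt_add_one _)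
  have hu₂' : u₂ ∈ nhdsWithin ((x, 0) : E × E) (tangentBundleSet M) :=
    nhdsWithin_le_of_mem hu hu₂
  have hall : ∀ᶠ p in nhdsWithin ((x, 0) : E × E) (tangentBundleSet M),
      p ∈ u ∧ p ∈ u₂ ∧ ‖f'' p‖ < ‖f'' (x, 0)‖ + 1 := by
    filter_upwards [hu, hu₂', nhdsWithin_le_of_mem hu₂' hbdd] with p h1 h2 h3 using ⟨h1, h2, h3⟩
  obtain ⟨r, hr, hball⟩ := Metric.mem_nhdsWithin_iff.1 hall
  refine ⟨r, hr, ‖f'' (x, 0)‖ + 1, by positivity, fun z hz hzx v hv hvr => ?_⟩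
  set C := ‖f'' (x, 0)‖ + 1
  let γ : ℝ → E × E := fun t => (z, t • v)
  have hγ : ∀ t ∈ Set.Icc (0 : ℝ) 1, γ t ∈ u ∧ γ t ∈ u₂ ∧ ‖f'' (γ t)‖ < C := by
    intro t ht
    refine hball ⟨?_, hz, Submodule.smul_mem _ _ hv⟩
    rw [Metric.mem_ball, Prod.dist_eq, dist_eq_norm, dist_eq_norm, sub_zero, max_lt_iff]
    refine ⟨hzx, ?_⟩
    simp only [γ, norm_smul, Real.norm_of_nonneg ht.1]
    nlinarith [norm_nonneg v, ht.2]
  have hγd : ∀ t, HasDerivWithinAt γ (0, v) (Set.Icc 0 1) t := by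
    intro t
    have h := (hasDerivAt_id t).smul_const v
    rw [one_smul] at h
    exact ((hasDerivAt_const t z).prodMk h).hasDerivWithinAt
  have hφ : ∀ t ∈ Set.Icc (0 : ℝ) 1,
      HasDerivWithinAt (fun t => R z (t • v)) (f' (γ t) (0, v)) (Set.Icc 0 1) t := fun t ht =>
    (hf' _ (hγ t ht).1).comp_hasDerivWithinAt t (hγd t) fun s hs => (hγ s hs).1
  have hφ' : ∀ t ∈ Set.Icc (0 : ℝ) 1,
      HasDerivWithinAt (fun t => f' (γ t) (0, v)) (f'' (γ t) (0, v) (0, v)) (Set.Icc 0 1) t := by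
    intro t ht
    have h := (hf'' _ (hγ t ht).2.1).comp_hasDerivWithinAt t (hγd t) fun s hs => (hγ s hs).2.1
    exact (ContinuousLinearMap.apply ℝ E ((0, v) : E × E)).hasFDerivAt.comp_hasDerivWithinAt t h
  have h00 : (0 : ℝ) ∈ Set.Icc (0 : ℝ) 1 := Set.left_mem_Icc.2 zero_le_one
  have h11 : (1 : ℝ) ∈ Set.Icc (0 : ℝ) 1 := Set.right_mem_Icc.2 zero_le_one
  have hzero : f' (γ 0) (0, v) = v :=
    (uniqueDiffOn_Icc zero_lt_one 0 h00).eq_deriv _ (hφ 0 h00)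
      (hR.deriv_zero z hz v hv).hasDerivWithinAt
  have hnorm : ‖((0, v) : E × E)‖ = ‖v‖ := by simp [Prod.norm_def]
  have hb2 : ∀ t ∈ Set.Icc (0 : ℝ) 1, ‖f'' (γ t) (0, v) (0, v)‖ ≤ C * ‖v‖ ^ 2 := by
    intro t ht
    calc _ ≤ ‖f'' (γ t)‖ * ‖((0, v) : E × E)‖ * ‖((0, v) : E × E)‖ :=
          ContinuousLinearMap.le_opNorm₂ _ _ _
      _ ≤ C * ‖v‖ ^ 2 := by
          rw [hnorm, mul_assoc, ← sq]
          exact mul_le_mul_of_nonneg_right (hγ t ht).2.2.le (by positivity)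
  have hb1 : ∀ t ∈ Set.Icc (0 : ℝ) 1, ‖f' (γ t) (0, v) - v‖ ≤ C * ‖v‖ ^ 2 := by
    intro t ht
    have h := norm_image_sub_le_of_norm_deriv_le_segment' hφ'
      (fun s hs => hb2 s ⟨hs.1, hs.2.le⟩) t ht
    rw [hzero] at h
    refine h.trans (mul_le_of_le_one_right (by positivity) (by linarith [ht.2]))
  have hψ : ∀ t ∈ Set.Icc (0 : ℝ) 1,
      HasDerivWithinAt (fun t => R z (t • v) - t • v) (f' (γ t) (0, v) - v) (Set.Icc 0 1) t := by
    intro t ht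
    have h := (hasDerivAt_id t).smul_const v
    rw [one_smul] at h
    exact (hφ t ht).sub h.hasDerivWithinAt
  have h := norm_image_sub_le_of_norm_deriv_le_segment' hψ
      (fun s hs => hb1 s ⟨hs.1, hs.2.le⟩) 1 h11
  simp only [one_smul, zero_smul, sub_zero, hR.at_zero z hz, mul_one] at h
  rwa [sub_sub, add_comm v z] at h

/-- On a compact submanifold the local estimates are uniform for short tangent vectors, and long
ones are controlled by the diameter. -/
lemma IsRetraction.exists_bounds {M : Set E} {R : E → E → E} (hR : IsRetraction M R)
    (hM : IsCompact M) : ∃ M₁ M₂ : ℝ, RetractionBounds M R M₁ M₂ := by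
  have hunif : ∃ r > 0, ∃ C ≥ 0, ∀ z ∈ M, z ∈ M → ∀ v ∈ tangentSpaceAt M z, ‖v‖ < r →
      ‖R z v - (z + v)‖ ≤ C * ‖v‖ ^ 2 := by
    refine hM.induction_on (p := fun s => ∃ r > 0, ∃ C ≥ 0, ∀ z ∈ s, z ∈ M →
      ∀ v ∈ tangentSpaceAt M z, ‖v‖ < r → ‖R z v - (z + v)‖ ≤ C * ‖v‖ ^ 2) ?_ ?_ ?_ ?_
    · exact ⟨1, one_pos, 0, le_rfl, fun z hz => absurd hz (Set.notMem_empty z)⟩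
    · rintro s t hst ⟨r, hr, C, hC, h⟩
      exact ⟨r, hr, C, hC, fun z hz => h z (hst hz)⟩
    · rintro s t ⟨r, hr, C, hC, h⟩ ⟨r', hr', C', hC', h'⟩
      refine ⟨min r r', lt_min hr hr', max C C', le_max_of_le_left hC, ?_⟩
      rintro z (hz | hz) hzM v hv hvr
      · exact (h z hz hzM v hv (hvr.trans_le (min_le_left _ _))).trans
          (mul_le_mul_of_nonneg_right (le_max_left _ _) (by positivity))
      · exact (h' z hz hzM v hv (hvr.trans_le (min_le_right _ _))).trans
          (mul_le_mul_of_nonneg_right (le_max_right _ _) (by positivity))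
    · intro x hx
      obtain ⟨r, hr, C, hC, h⟩ := hR.exists_local_bound hx
      refine ⟨Metric.ball x r, mem_nhdsWithin_of_mem_nhds (Metric.ball_mem_nhds x hr),
        r, hr, C, hC, fun z hz hzM v hv hvr => h z hzM ?_ v hv hvr⟩
      rwa [Metric.mem_ball, dist_eq_norm] at hz
  obtain ⟨r, hr, C, hC, h⟩ := hunif
  have hdiam : ∀ x ∈ M, ∀ v ∈ tangentSpaceAt M x, ‖R x v - x‖ ≤ Metric.diam M := by
    intro x hx v hv
    rw [← dist_eq_norm]
    exact Metric.dist_le_diam_of_mem hM.isBounded (hR.maps_to x hx v hv) hx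
  set D := Metric.diam M with hDdef
  have hD : 0 ≤ D := Metric.diam_nonneg
  refine ⟨1 + C * r + D / r, 1 + C + (D / r ^ 2 + 1 / r), by positivity, by positivity,
    fun x hx v hv => ?_⟩
  rcases lt_or_ge ‖v‖ r with hvr | hvr
  · have h1 := h x hx hx v hv hvr
    constructor
    · have h2 : ‖R x v - x‖ ≤ ‖R x v - (x + v)‖ + ‖v‖ := by
        have := norm_add_le (R x v - (x + v)) v
        rwa [show R x v - (x + v) + v = R x v - x by abel] at this
      have h3 : C * ‖v‖ ^ 2 ≤ C * r * ‖v‖ := by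
        have := mul_le_mul_of_nonneg_left hvr.le (mul_nonneg hC (norm_nonneg v))
        nlinarith
      have h4 : 0 ≤ D / r * ‖v‖ := by positivity
      nlinarith
    · have h4 : 0 ≤ (1 + (D / r ^ 2 + 1 / r)) * ‖v‖ ^ 2 := by positivity
      nlinarith
  · have h1 := hdiam x hx v hv
    have h2 : 1 ≤ ‖v‖ / r := by rwa [le_div_iff₀ hr, one_mul]
    constructor
    · have h3 : D ≤ D / r * ‖v‖ := by
        rw [div_mul_eq_mul_div, mul_div_assoc]
        exact le_mul_of_one_le_right hD h2
      have h4 : 0 ≤ (1 + C * r) * ‖v‖ := by positivity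
      nlinarith
    · have h3 : ‖R x v - (x + v)‖ ≤ D + ‖v‖ := by
        rw [← sub_sub]
        exact (norm_sub_le _ _).trans (by linarith)
      have h4 : D ≤ D / r ^ 2 * ‖v‖ ^ 2 := by
        have : D / r ^ 2 * ‖v‖ ^ 2 = D * (‖v‖ / r) ^ 2 := by field_simp
        rw [this]
        exact le_mul_of_one_le_right hD (one_le_pow₀ h2)
      have h5 : ‖v‖ ≤ 1 / r * ‖v‖ ^ 2 := by
        have : 1 / r * ‖v‖ ^ 2 = ‖v‖ * (‖v‖ / r) := by field_simp
        rw [this]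
        exact le_mul_of_one_le_right (norm_nonneg v) h2
      have h6 : 0 ≤ (1 + C) * ‖v‖ ^ 2 := by positivity
      nlinarith

end Retraction

/-! ### Regularity of the problem and the two proximal subproblems -/

lemma argmaxOn_spec {E : Type*} [NormedAddCommGroup E] {C : Set E} {φ : E → ℝ}
    (h : ∃ u ∈ C, IsMaxOn φ C u) : argmaxOn C φ ∈ C ∧ IsMaxOn φ C (argmaxOn C φ) :=
  Classical.epsilon_spec (p := fun u => u ∈ C ∧ IsMaxOn φ C u) h

lemma argminOn_spec {E : Type*} [NormedAddCommGroup E] {C : Set E} {φ : E → ℝ}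
    (h : ∃ u ∈ C, IsMinOn φ C u) : argminOn C φ ∈ C ∧ IsMinOn φ C (argminOn C φ) :=
  Classical.epsilon_spec (p := fun u => u ∈ C ∧ IsMinOn φ C u) h

namespace Problem.Standing

variable {E₁ E₂ : Type*} [NormedAddCommGroup E₁] [InnerProductSpace ℝ E₁] [FiniteDimensional ℝ E₁]
  [NormedAddCommGroup E₂] [InnerProductSpace ℝ E₂] [FiniteDimensional ℝ E₂]
  {P : Problem E₁ E₂} {Lx Ly Lh : ℝ}

lemma hasFDerivAt_left (hP : P.Standing Lx Ly Lh) (x : E₁) (y : E₂) :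
    HasFDerivAt (fun x' => P.f x' y)
      ((fderiv ℝ (fun p : E₁ × E₂ => P.f p.1 p.2) (x, y)).comp
        (ContinuousLinearMap.inl ℝ E₁ E₂)) x :=
  HasFDerivAt.comp (g := fun p : E₁ × E₂ => P.f p.1 p.2) (f := fun x' => (x', y)) x
    ((hP.f_C1.differentiable one_ne_zero) (x, y)).hasFDerivAt (hasFDerivAt_prodMk_left x y)

lemma hasFDerivAt_right (hP : P.Standing Lx Ly Lh) (x : E₁) (y : E₂) :
    HasFDerivAt (fun y' => P.f x y')
      ((fderiv ℝ (fun p : E₁ × E₂ => P.f p.1 p.2) (x, y)).comp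
        (ContinuousLinearMap.inr ℝ E₁ E₂)) y :=
  HasFDerivAt.comp (g := fun p : E₁ × E₂ => P.f p.1 p.2) y
    ((hP.f_C1.differentiable one_ne_zero) (x, y)).hasFDerivAt (hasFDerivAt_prodMk_right x y)

lemma hasGradientAt_gradX (hP : P.Standing Lx Ly Lh) (y : E₂) (x : E₁) :
    HasGradientAt (fun x' => P.f x' y) (P.gradX x y) x :=
  (hP.hasFDerivAt_left x y).differentiableAt.hasGradientAt

lemma hasGradientAt_gradY (hP : P.Standing Lx Ly Lh) (x : E₁) (y : E₂) :
    HasGradientAt (fun y' => P.f x y') (P.gradY x y) y :=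
  (hP.hasFDerivAt_right x y).differentiableAt.hasGradientAt

lemma continuous_gradX (hP : P.Standing Lx Ly Lh) :
    Continuous fun p : E₁ × E₂ => P.gradX p.1 p.2 := by
  have h := hP.f_C1.continuous_fderiv one_ne_zero
  have e : (fun p : E₁ × E₂ => P.gradX p.1 p.2) = fun p =>
      (InnerProductSpace.toDual ℝ E₁).symm
        ((fderiv ℝ (fun p : E₁ × E₂ => P.f p.1 p.2) p).comp
          (ContinuousLinearMap.inl ℝ E₁ E₂)) := by
    funext p
    rw [gradX, gradient, (hP.hasFDerivAt_left p.1 p.2).fderiv]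
  rw [e]
  exact (LinearIsometryEquiv.continuous _).comp (h.clm_comp continuous_const)

lemma continuous_gradY (hP : P.Standing Lx Ly Lh) (x : E₁) : Continuous (P.gradY x) := by
  have h := hP.f_C1.continuous_fderiv one_ne_zero
  have e : P.gradY x = fun y => (InnerProductSpace.toDual ℝ E₂).symm
        ((fderiv ℝ (fun p : E₁ × E₂ => P.f p.1 p.2) (x, y)).comp
          (ContinuousLinearMap.inr ℝ E₁ E₂)) := by
    funext y
    rw [gradY, gradient, (hP.hasFDerivAt_right x y).fderiv]
  rw [e]
  exact (LinearIsometryEquiv.continuous _).comp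
    ((h.comp (by fun_prop : Continuous fun y : E₂ => (x, y))).clm_comp continuous_const)

lemma continuous_g (hP : P.Standing Lx Ly Lh) : Continuous P.g :=
  continuous_of_convexOn_univ hP.g_convex

lemma continuous_h (hP : P.Standing Lx Ly Lh) : Continuous P.h :=
  continuous_of_convexOn_univ hP.h_convex

lemma continuous_F (hP : P.Standing Lx Ly Lh) : Continuous fun p : E₁ × E₂ => P.F p.1 p.2 :=
  (hP.f_C1.continuous.add (hP.continuous_h.comp continuous_fst)).sub
    (hP.continuous_g.comp continuous_snd)

lemma norm_le_σy (hP : P.Standing Lx Ly Lh) {y : E₂} (hy : y ∈ P.S) : ‖y‖ ≤ P.σy :=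
  le_csSup (hP.compact_S.image continuous_norm).bddAbove ⟨y, hy, rfl⟩

lemma σy_nonneg (_ : P.Standing Lx Ly Lh) : 0 ≤ P.σy :=
  Real.sSup_nonneg (by rintro _ ⟨y, -, rfl⟩; exact norm_nonneg y)

lemma norm_sub_le_two_σy (hP : P.Standing Lx Ly Lh) {y z : E₂} (hy : y ∈ P.S) (hz : z ∈ P.S) :
    ‖y - z‖ ≤ 2 * P.σy :=
  (norm_sub_le y z).trans (by linarith [hP.norm_le_σy hy, hP.norm_le_σy hz])

lemma norm_gradX_le (hP : P.Standing Lx Ly Lh) {x : E₁} {y : E₂} (hx : x ∈ P.M) (hy : y ∈ P.S) :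
    ‖P.gradX x y‖ ≤ P.gradBound :=
  le_csSup ((hP.compact_M.prod hP.compact_S).image hP.continuous_gradX.norm).bddAbove
    ⟨(x, y), ⟨hx, hy⟩, rfl⟩

lemma gradBound_nonneg (_ : P.Standing Lx Ly Lh) : 0 ≤ P.gradBound :=
  Real.sSup_nonneg (by rintro _ ⟨p, -, rfl⟩; exact norm_nonneg _)

lemma norm_gradY_sub_le (hP : P.Standing Lx Ly Lh) {X : Set E₁} (hX : P.LipschitzGradY X Ly)
    {x : E₁} (hx : x ∈ X) {y z : E₂} (hy : y ∈ P.S) (hz : z ∈ P.S) :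
    ‖P.gradY x y - P.gradY x z‖ ≤ Ly * ‖y - z‖ := by
  have h := hX x hx x hx y hy z hz
  rw [sub_self, norm_zero, zero_pow two_ne_zero, zero_add, ← mul_pow] at h
  exact le_of_sq_le_sq h (mul_nonneg hP.Ly_pos.le (norm_nonneg _))

lemma norm_gradY_sub_le' (hP : P.Standing Lx Ly Lh) {X : Set E₁} (hX : P.LipschitzGradY X Ly)
    {x₁ x₂ : E₁} (hx₁ : x₁ ∈ X) (hx₂ : x₂ ∈ X) {y : E₂} (hy : y ∈ P.S) :
    ‖P.gradY x₁ y - P.gradY x₂ y‖ ≤ Ly * ‖x₁ - x₂‖ := by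
  have h := hX x₁ hx₁ x₂ hx₂ y hy y hy
  rw [sub_self, norm_zero, zero_pow two_ne_zero, add_zero, ← mul_pow] at h
  exact le_of_sq_le_sq h (mul_nonneg hP.Ly_pos.le (norm_nonneg _))

lemma yhat_spec (hP : P.Standing Lx Ly Lh) (A : Params) (k : ℤ) {yk : E₂} (hyk : yk ∈ P.S)
    (x : E₁) :
    P.yhat A k yk x ∈ P.S ∧ IsMaxOn (fun y => ⟪P.gradY x yk - A.γ k • yk, y - yk⟫_ℝ
      - 1 / (2 * A.ρ) * ‖y - yk‖ ^ 2 - P.g y) P.S (P.yhat A k yk x) := by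
  have hg := hP.continuous_g
  exact argmaxOn_spec (hP.compact_S.exists_isMaxOn ⟨yk, hyk⟩ (by fun_prop))

/-- The variational inequality that characterizes the proximal ascent step. -/
lemma yhat_variational (hP : P.Standing Lx Ly Lh) (A : Params) (k : ℤ) {yk : E₂}
    (hyk : yk ∈ P.S) (x : E₁) {w : E₂} (hw : w ∈ P.S) :
    ⟪P.gradY x yk - A.γ k • yk - (1 / A.ρ) • (P.yhat A k yk x - yk), w - P.yhat A k yk x⟫_ℝ
      ≤ P.g w - P.g (P.yhat A k yk x) := by
  obtain ⟨hmem, hmax⟩ := hP.yhat_spec A k hyk x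
  set y := P.yhat A k yk x
  set c := P.gradY x yk - A.γ k • yk
  have hconv : ConvexOn ℝ Set.univ (fun z => P.g z - ⟪c, z⟫_ℝ) :=
    hP.g_convex.sub ((innerₛₗ ℝ c).concaveOn convex_univ)
  have h := le_add_inner_of_isMinOn_prox hP.convex_S hconv (c := 1 / A.ρ) (y₀ := yk) hmem
    (isMinOn_iff.2 fun z hz => by
      have h1 := isMaxOn_iff.1 hmax z hz
      simp only [inner_sub_right] at h1
      have e : 1 / A.ρ / 2 = 1 / (2 * A.ρ) := by rw [div_div, mul_comm]
      rw [e]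
      linarith) hw
  rw [inner_sub_left, real_inner_smul_left, inner_sub_right c]
  linarith

lemma proxDir_spec (hP : P.Standing Lx Ly Lh) {β : ℝ} (hβ : 0 < β) (x : E₁) (y : E₂) :
    P.proxDir β x y ∈ tangentSpaceAt P.M x ∧
      IsMinOn (fun v => ⟪P.gradX x y, v⟫_ℝ + P.h (x + v) + β / 2 * ‖v‖ ^ 2)
        (tangentSpaceAt P.M x : Set E₁) (P.proxDir β x y) := by
  have hh := hP.continuous_h
  set T := tangentSpaceAt P.M x
  set φ : E₁ → ℝ := fun v => ⟪P.gradX x y, v⟫_ℝ + P.h (x + v) + β / 2 * ‖v‖ ^ 2 with hφ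
  have hφc : Continuous φ := by fun_prop
  set r := 2 * (‖P.gradX x y‖ + Lh) / β with hr
  have hr0 : 0 ≤ r := by have := hP.Lh_nonneg; positivity
  -- outside the ball of radius `r` the quadratic term beats the linear growth of the rest
  have hcoer : ∀ v, r < ‖v‖ → φ 0 ≤ φ v := by
    intro v hv
    have h1 : -(‖P.gradX x y‖ * ‖v‖) ≤ ⟪P.gradX x y, v⟫_ℝ :=
      neg_le_of_abs_le (abs_real_inner_le_norm _ _)
    have h2 := hP.lip_h x (x + v)
    rw [sub_add_cancel_left, norm_neg] at h2
    have h3 := le_of_abs_le h2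
    have h4 : (‖P.gradX x y‖ + Lh) * ‖v‖ ≤ β / 2 * ‖v‖ ^ 2 := by
      rw [hr, div_lt_iff₀ hβ] at hv
      nlinarith [norm_nonneg v]
    simp only [hφ, inner_zero_right, add_zero, norm_zero]
    nlinarith
  have hcomp : IsCompact ((T : Set E₁) ∩ Metric.closedBall 0 r) :=
    (isCompact_closedBall 0 r).inter_left (Submodule.closed_of_finiteDimensional T)
  obtain ⟨u, hu, humin⟩ := hcomp.exists_isMinOn
    ⟨0, T.zero_mem, Metric.mem_closedBall_self hr0⟩ hφc.continuousOn
  refine argminOn_spec ⟨u, hu.1, isMinOn_iff.2 fun v hv => ?_⟩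
  rcases le_or_gt ‖v‖ r with h | h
  · exact isMinOn_iff.1 humin v ⟨hv, by simpa using h⟩
  · exact (isMinOn_iff.1 humin 0 ⟨T.zero_mem, Metric.mem_closedBall_self hr0⟩).trans (hcoer v h)

lemma convexOn_linearized (hP : P.Standing Lx Ly Lh) (c x : E₁) :
    ConvexOn ℝ Set.univ (fun v => ⟪c, v⟫_ℝ + P.h (x + v)) := by
  refine ((innerₛₗ ℝ c).convexOn convex_univ).add ?_
  have := hP.h_convex.translate_right x
  simpa [Function.comp_def] using this

/-- The variational inequality that characterizes the tangential proximal step. -/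
lemma proxDir_variational (hP : P.Standing Lx Ly Lh) {β : ℝ} (hβ : 0 < β) (x : E₁) (y : E₂)
    {w : E₁} (hw : w ∈ tangentSpaceAt P.M x) :
    ⟪P.gradX x y, P.proxDir β x y⟫_ℝ + P.h (x + P.proxDir β x y)
      ≤ ⟪P.gradX x y, w⟫_ℝ + P.h (x + w) + β * ⟪P.proxDir β x y, w - P.proxDir β x y⟫_ℝ := by
  obtain ⟨hmem, hmin⟩ := hP.proxDir_spec hβ x y
  have h := le_add_inner_of_isMinOn_prox (Submodule.convex _)
    (hP.convexOn_linearized (P.gradX x y) x) (c := β) (y₀ := 0) hmem (by simpa using hmin) hw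
  simpa using h

end Problem.Standing

/-! ### The step parameters -/

/-- `(k + κ + 2)^{1/4}`, so that `γ_k = 2 / (ρ · root k)`. -/
noncomputable def Params.root (A : Params) (k : ℤ) : ℝ := ((k : ℝ) + A.κ + 2) ^ (1 / 4 : ℝ)

lemma Params.γ_eq (A : Params) (k : ℤ) : A.γ k = 2 / (A.ρ * A.root k) := rfl

namespace Params.Admissible

variable {A : Params} {Ly : ℝ}

lemma root_pow (hA : A.Admissible Ly) {k : ℤ} (hk : -1 ≤ k) :
    A.root k ^ 4 = (k : ℝ) + A.κ + 2 := by
  have h1 : (-1 : ℝ) ≤ k := by exact_mod_cast hk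
  have h := hA.κ_gt
  rw [root, ← Real.rpow_natCast, ← Real.rpow_mul (by linarith)]
  norm_num

lemma two_lt_root (hA : A.Admissible Ly) {k : ℤ} (hk : -1 ≤ k) : 2 < A.root k := by
  have h1 : (-1 : ℝ) ≤ k := by exact_mod_cast hk
  have h := hA.κ_gt
  have h0 : 0 ≤ A.root k := Real.rpow_nonneg (by linarith) _
  refine lt_of_pow_lt_pow_left₀ 4 h0 ?_
  rw [hA.root_pow hk]
  linarith

lemma root_pos (hA : A.Admissible Ly) {k : ℤ} (hk : -1 ≤ k) : 0 < A.root k :=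
  two_pos.trans (hA.two_lt_root hk)

lemma root_mono (hA : A.Admissible Ly) {j k : ℤ} (hj : -1 ≤ j) (hjk : j ≤ k) :
    A.root j ≤ A.root k := by
  have h1 : (-1 : ℝ) ≤ j := by exact_mod_cast hj
  have h2 : (j : ℝ) ≤ k := by exact_mod_cast hjk
  have h := hA.κ_gt
  exact Real.rpow_le_rpow (by linarith) (by linarith) (by norm_num)

lemma root_succ_sub_le (hA : A.Admissible Ly) {k : ℤ} (hk : -1 ≤ k) :
    A.root (k + 1) - A.root k ≤ 1 / 5 := by
  have h1 := hA.root_pow hk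
  have h2 := hA.root_pow (k := k + 1) (by omega)
  have h3 := hA.two_lt_root hk
  have h4 := hA.root_mono hk (le_add_of_nonneg_right zero_le_one)
  push_cast at h2
  set s := A.root k
  set t := A.root (k + 1)
  have h5 : (t - s) * ((t + s) * (t ^ 2 + s ^ 2)) = 1 := by nlinarith
  have h6 : 5 ≤ (t + s) * (t ^ 2 + s ^ 2) := by nlinarith
  nlinarith

/-- The ratios `γ_{k-1} / γ_k` decrease. -/
lemma root_mul_root_le (hA : A.Admissible Ly) {k : ℤ} (hk : 0 ≤ k) :
    A.root (k + 1) * A.root (k - 1) ≤ A.root k ^ 2 := by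
  refine le_of_sq_le_sq ?_ (sq_nonneg _)
  have e1 := hA.root_pow (k := k) (by omega)
  have e2 := hA.root_pow (k := k + 1) (by omega)
  have e3 := hA.root_pow (k := k - 1) (by omega)
  have h1 := hA.root_pos (k := k + 1) (by omega)
  have h2 := hA.root_pos (k := k - 1) (by omega)
  refine le_of_sq_le_sq ?_ (sq_nonneg _)
  push_cast at e2 e3
  calc ((A.root (k + 1) * A.root (k - 1)) ^ 2) ^ 2
      = A.root (k + 1) ^ 4 * A.root (k - 1) ^ 4 := by ring
    _ ≤ (A.root k ^ 4) ^ 2 := by rw [e1, e2, e3]; nlinarith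
    _ = ((A.root k ^ 2) ^ 2) ^ 2 := by ring

lemma γ_pos (hA : A.Admissible Ly) {k : ℤ} (hk : -1 ≤ k) : 0 < A.γ k := by
  have := hA.root_pos hk
  have := hA.ρ_pos
  rw [γ_eq]
  positivity

lemma γ_anti (hA : A.Admissible Ly) {j k : ℤ} (hj : -1 ≤ j) (hjk : j ≤ k) :
    A.γ k ≤ A.γ j := by
  have h1 := hA.root_pos hj
  have h2 := hA.ρ_pos
  rw [γ_eq, γ_eq]
  exact div_le_div_of_nonneg_left zero_le_two (by positivity)
    (mul_le_mul_of_nonneg_left (hA.root_mono hj hjk) h2.le)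

/-- The step size condition bounds `ρ` by the inverse smoothness of the regularized objective. -/
lemma ρ_mul_add_γ_le (hA : A.Admissible Ly) (hLy : 0 < Ly) {k : ℤ} (hk : -1 ≤ k) :
    A.ρ * (Ly + A.γ k) ≤ 1 := by
  have h1 := hA.ρ_pos
  have hκ := hA.κ_gt
  have h2 : A.ρ * A.γ (-1) = 2 * (A.κ + 1) ^ (-(1 / 4) : ℝ) := by
    rw [γ_eq, root, Real.rpow_neg (by linarith)]
    push_cast
    rw [show -1 + A.κ + 2 = A.κ + 1 by ring]
    have : 0 < (A.κ + 1) ^ (1 / 4 : ℝ) := Real.rpow_pos_of_pos (by linarith) _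
    field_simp
  have h3 := hA.ρ_le
  rw [le_div_iff₀ hLy] at h3
  have h4 := mul_le_mul_of_nonneg_left (hA.γ_anti le_rfl hk) h1.le
  rw [mul_add]
  linarith

lemma γ_div_γ (hA : A.Admissible Ly) {j k : ℤ} (hj : -1 ≤ j) (hk : -1 ≤ k) :
    A.γ j / A.γ k = A.root k / A.root j := by
  have h1 := hA.root_pos hj
  have h2 := hA.root_pos hk
  have h3 := hA.ρ_pos
  rw [γ_eq, γ_eq]
  field_simp

lemma four_div_γ (hA : A.Admissible Ly) {k : ℤ} (hk : -1 ≤ k) :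
    4 / (A.ρ ^ 2 * A.γ k) = 2 * A.root k / A.ρ := by
  have h2 := hA.root_pos hk
  have h3 := hA.ρ_pos
  rw [γ_eq]
  field_simp
  norm_num

end Params.Admissible

/-! ### The dual step -/

namespace Problem.Standing

variable {E₁ E₂ : Type*} [NormedAddCommGroup E₁] [InnerProductSpace ℝ E₁] [FiniteDimensional ℝ E₁]
  [NormedAddCommGroup E₂] [InnerProductSpace ℝ E₂] [FiniteDimensional ℝ E₂]
  {P : Problem E₁ E₂} {Lx Ly Lh : ℝ} {A : Params}

/-- The regularized dual gradient `∇_y f(x,·) - γ ·` is smooth enough for step sizes `ρ` with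
`ρ (L_y + γ) ≤ 1`: its increment, tested with the next dual step `u - b`, is absorbed by the second
difference of the dual iterates. -/
lemma inner_gradY_increment_le (hP : P.Standing Lx Ly Lh) {x : E₁} (hx : x ∈ P.M) {ρ γ : ℝ}
    (hρ : 0 < ρ) (hγ : 0 < γ) (hργ : ρ * (Ly + γ) ≤ 1) {a b u : E₂}
    (ha : a ∈ P.S) (hb : b ∈ P.S) (hu : u ∈ P.S) :
    ⟪P.gradY x b - P.gradY x a - γ • (b - a), u - b⟫_ℝ
      ≤ 1 / (2 * ρ) * ‖(u - b) - (b - a)‖ ^ 2 - γ / 2 * ‖b - a‖ ^ 2 := by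
  let φ : E₂ → ℝ := fun z => -P.f x z + γ / 2 * ‖z‖ ^ 2
  let G : E₂ → E₂ := fun z => -P.gradY x z + γ • z
  have hneg : ∀ z, HasGradientAt (fun z => -P.f x z) (-P.gradY x z) z :=
    fun z => hasGradientAt_neg (hP.hasGradientAt_gradY x z)
  have hφ : ∀ z, HasGradientAt φ (G z) z := by
    intro z
    have h := (hneg z).hasFDerivAt.add
      ((hasStrictFDerivAt_norm_sq z).hasFDerivAt.const_mul (γ / 2))
    rw [hasGradientAt_iff_hasFDerivAt]
    refine h.congr_fderiv ?_
    ext w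
    simp [G]
    ring
  have hconv : ConvexOn ℝ Set.univ (fun z => -P.f x z) := (hP.f_concave x).neg
  have hφc : ConvexOn ℝ Set.univ φ :=
    hconv.add (((convexOn_norm convex_univ).pow (fun _ _ => norm_nonneg _) 2).smul
      (half_pos hγ).le)
  have hGc : Continuous G := (hP.continuous_gradY x).neg.add (continuous_const_smul γ)
  have hlip : ∀ z ∈ P.S, ∀ w ∈ P.S, ‖G z - G w‖ ≤ (Ly + γ) * ‖z - w‖ := by
    intro z hz w hw
    have e : G z - G w = (P.gradY x w - P.gradY x z) + γ • (z - w) := by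
      simp only [G]; module
    rw [e, add_mul]
    refine (norm_add_le _ _).trans (add_le_add ?_ ?_)
    · rw [norm_sub_rev z w]
      exact hP.norm_gradY_sub_le hP.lip_y hx hw hz
    · rw [norm_smul, Real.norm_of_nonneg hγ.le]
  have hLy := hP.Ly_pos
  have hcoc := inner_sq_le_second_difference hφ hGc hφc hP.convex_S (by linarith) hlip ha hb hu
  set D := (u - b) - (b - a) with hD
  set Q := P.gradY x b - P.gradY x a - γ • (b - a) with hQ
  have eQ : G b - G a = -Q := by simp only [G, hQ]; module
  rw [eQ, inner_neg_left, inner_neg_left, neg_sq] at hcoc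
  have hmono : γ * ‖b - a‖ ^ 2 ≤ -⟪Q, b - a⟫_ℝ := by
    have h1 := ConvexOn.add_inner_gradient_le hneg hconv a b
    have h2 := ConvexOn.add_inner_gradient_le hneg hconv b a
    rw [← neg_sub b a, inner_neg_right] at h2
    rw [hQ, inner_sub_left, inner_sub_left, real_inner_smul_left, real_inner_self_eq_norm_sq]
    simp only [inner_neg_left] at h1 h2
    linarith
  have e1 : ⟪Q, u - b⟫_ℝ = ⟪Q, b - a⟫_ℝ + ⟪Q, D⟫_ℝ := by
    rw [← inner_add_right, hD, add_sub_cancel]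
  set w := -⟪Q, b - a⟫_ℝ with hw
  have hw0 : 0 ≤ w := le_trans (by positivity) hmono
  have hsq : (2 * ⟪Q, D⟫_ℝ) ^ 2 ≤ (1 / ρ * ‖D‖ ^ 2 + w) ^ 2 := by
    have h1 : Ly + γ ≤ 1 / ρ := by rw [le_div_iff₀ hρ]; linarith
    have h2 : ⟪Q, D⟫_ℝ ^ 2 ≤ 1 / ρ * ‖D‖ ^ 2 * w :=
      hcoc.trans (mul_le_mul_of_nonneg_right
        (mul_le_mul_of_nonneg_right h1 (by positivity)) hw0)
    nlinarith [sq_nonneg (1 / ρ * ‖D‖ ^ 2 - w)]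
  have hD' := le_of_abs_le (abs_le_of_sq_le_sq hsq (by positivity))
  have e2 : 1 / (2 * ρ) * ‖D‖ ^ 2 = (1 / ρ * ‖D‖ ^ 2) / 2 := by field_simp
  rw [e1, e2]
  linarith

/-- The two consequences of two consecutive dual steps `y⁻ ↦ y ↦ y⁺` on which the potential is
built: an ascent estimate for the regularized objective, and a recursion for the length of the dual
steps. -/
lemma dual_step (hP : P.Standing Lx Ly Lh) (hA : A.Admissible Ly) {k : ℤ} (hk : 0 ≤ k)
    {x x' : E₁} (hx : x ∈ P.M) {y₀ y y' : E₂} (hy₀ : y₀ ∈ P.S)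
    (hy : y = P.yhat A (k - 1) y₀ x) (hy' : y' = P.yhat A k y x') :
    (P.F x' y' - A.γ k / 2 * ‖y'‖ ^ 2 - (P.F x' y - A.γ k / 2 * ‖y‖ ^ 2)
      ≤ ⟪P.gradY x' y - P.gradY x y, y' - y⟫_ℝ
        + 1 / A.ρ / 2 * (‖y' - y‖ ^ 2 + ‖y - y₀‖ ^ 2) - A.γ (k - 1) / 2 * ‖y - y₀‖ ^ 2
        - A.γ k / 2 * ‖y' - y‖ ^ 2
        + (A.γ (k - 1) - A.γ k) / 2 * (‖y'‖ ^ 2 - ‖y‖ ^ 2 - ‖y' - y‖ ^ 2)) ∧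
    (1 / A.ρ / 2 * (‖y' - y‖ ^ 2 - ‖y - y₀‖ ^ 2)
      ≤ ⟪P.gradY x' y - P.gradY x y, y' - y⟫_ℝ - A.γ (k - 1) / 2 * ‖y - y₀‖ ^ 2
        + (A.γ (k - 1) - A.γ k) / 2 * (‖y'‖ ^ 2 - ‖y‖ ^ 2 - ‖y' - y‖ ^ 2)) := by
  have hyS : y ∈ P.S := hy ▸ (hP.yhat_spec A (k - 1) hy₀ x).1
  have hyS' : y' ∈ P.S := hy' ▸ (hP.yhat_spec A k hyS x').1
  have V1 := hP.yhat_variational A (k - 1) hy₀ x hyS'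
  have V2 := hP.yhat_variational A k hyS x' hyS
  rw [← hy] at V1
  rw [← hy'] at V2
  have hconv : ConvexOn ℝ Set.univ (fun z => -P.f x' z) := (hP.f_concave x').neg
  have hneg : ∀ z, HasGradientAt (fun z => -P.f x' z) (-P.gradY x' z) z :=
    fun z => hasGradientAt_neg (hP.hasGradientAt_gradY x' z)
  have C := ConvexOn.add_inner_gradient_le hneg hconv y y'
  have K := hP.inner_gradY_increment_le hx hA.ρ_pos (hA.γ_pos (k := k - 1) (by omega))
    (hA.ρ_mul_add_γ_le hP.Ly_pos (by omega)) hy₀ hyS hyS'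
  have e0 : y - y' = -(y' - y) := (neg_sub _ _).symm
  have e1 : ‖y'‖ ^ 2 = ‖y‖ ^ 2 + 2 * ⟪y, y' - y⟫_ℝ + ‖y' - y‖ ^ 2 := by
    rw [← norm_add_sq_real, add_sub_cancel]
  have e2 := norm_sub_sq_real (y' - y) (y - y₀)
  rw [e0, inner_neg_right] at V2
  have e4 : ⟪y₀, y' - y⟫_ℝ = ⟪y, y' - y⟫_ℝ - ⟪y' - y, y - y₀⟫_ℝ := by
    rw [real_inner_comm (y - y₀) (y' - y), ← inner_sub_left, sub_sub_cancel]
  simp only [inner_sub_left (𝕜 := ℝ) (P.gradY _ _), inner_sub_left (𝕜 := ℝ) (_ - _) (_ • _),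
    real_inner_smul_left, inner_neg_left, real_inner_self_eq_norm_sq,
    real_inner_comm (y' - y) (y - y₀), e4] at V1 V2 C K ⊢
  rw [e2] at K
  rw [e1]
  have e5 : 1 / (2 * A.ρ) = 1 / A.ρ / 2 := by rw [div_div, mul_comm]
  rw [e5] at K
  simp only [F]
  constructor <;> nlinarith

end Problem.Standing

/-! ### Decrease of the potential -/

/-- The potential with all step parameters written through `Params.root`. -/
lemma Problem.calF_eq {E₁ E₂ : Type*} [NormedAddCommGroup E₂] (P : Problem E₁ E₂) {A : Params}
    {Ly : ℝ} (hA : A.Admissible Ly) {k : ℤ} (hk : 0 ≤ k) (yprev : E₂)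
    (x : E₁) (y : E₂) :
    P.calF A k yprev x y = P.F x y - A.γ (k - 1) / 2 * ‖y‖ ^ 2 + 1 / A.ρ / 2 * ‖y - yprev‖ ^ 2
      + (4 * (1 / A.ρ) * (A.root k / A.root (k - 1)) + A.γ (k - 1) / 2) * P.σy ^ 2
      + (2 * (1 / A.ρ) * A.root k - 4 * (1 / A.ρ)) * ‖y - yprev‖ ^ 2
      + 4 * (1 / A.ρ) * (1 - A.root k / A.root (k - 1)) * ‖y‖ ^ 2 := by
  rw [calF, calH, Freg, hA.γ_div_γ (by omega) (by omega), hA.four_div_γ (by omega)]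
  rw [show 1 / (2 * A.ρ) = 1 / A.ρ / 2 by rw [div_div, mul_comm],
    show 4 / A.ρ = 4 * (1 / A.ρ) by ring,
    show 2 * A.root k / A.ρ = 2 * (1 / A.ρ) * A.root k by ring]
  ring

namespace Problem.Standing

variable {E₁ E₂ : Type*} [NormedAddCommGroup E₁] [InnerProductSpace ℝ E₁] [FiniteDimensional ℝ E₁]
  [NormedAddCommGroup E₂] [InnerProductSpace ℝ E₂] [FiniteDimensional ℝ E₂]
  {P : Problem E₁ E₂} {Lx Ly Lh : ℝ} {A : Params}

/-- Change of the potential in one iteration, for an arbitrary primal point `x'`: it is controlled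
by the change of `F` in `x` and by the resulting change of `∇_y f`. The recursion for the dual steps
enters with the weight `4 (k + κ + 2)^{1/4} = 8 / (ρ γ_k)`. -/
lemma calF_sub_le (hP : P.Standing Lx Ly Lh) (hA : A.Admissible Ly) {k : ℤ} (hk : 0 ≤ k)
    {x x' : E₁} (hx : x ∈ P.M) {y₀ y y' : E₂} (hy₀ : y₀ ∈ P.S)
    (hy : y = P.yhat A (k - 1) y₀ x) (hy' : y' = P.yhat A k y x') :
    P.calF A (k + 1) y x' y' - P.calF A k y₀ x y
      ≤ P.F x' y - P.F x y
        + (A.ρ / 2 + 8 / (A.ρ * A.γ k ^ 2)) * ‖P.gradY x' y - P.gradY x y‖ ^ 2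
        - 1 / (10 * A.ρ) * ‖y' - y‖ ^ 2 := by
  have hyS : y ∈ P.S := hy ▸ (hP.yhat_spec A (k - 1) hy₀ x).1
  have hyS' : y' ∈ P.S := hy' ▸ (hP.yhat_spec A k hyS x').1
  obtain ⟨B, I⟩ := hP.dual_step hA hk hx hy₀ hy hy'
  rw [P.calF_eq hA hk, P.calF_eq hA (k := k + 1) (by omega), add_sub_cancel_right]
  have hρ := hA.ρ_pos
  have hs₀ := hA.root_pos (k := k - 1) (by omega)
  have hs₁ := hA.root_pos (k := k) (by omega)
  have hs₂ := hA.root_succ_sub_le (k := k) (by omega)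
  have hlog := hA.root_mul_root_le hk
  have hmono := hA.root_mono (j := k - 1) (k := k) (by omega) (by omega)
  have hγ₀ := hA.γ_pos (k := k - 1) (by omega)
  have hγ₁ := hA.γ_pos (k := k) (by omega)
  have hγ := hA.γ_anti (j := k - 1) (k := k) (by omega) (by omega)
  have hY : ‖y‖ ^ 2 ≤ P.σy ^ 2 := pow_le_pow_left₀ (norm_nonneg _) (hP.norm_le_σy hyS) 2
  have hY' : ‖y'‖ ^ 2 ≤ P.σy ^ 2 := pow_le_pow_left₀ (norm_nonneg _) (hP.norm_le_σy hyS') 2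
  have e0 : A.root k * A.γ (k - 1) = 2 * (1 / A.ρ) * (A.root k / A.root (k - 1)) := by
    rw [Params.γ_eq]; field_simp
  have e1 : A.root k * A.γ k = 2 * (1 / A.ρ) := by
    rw [Params.γ_eq]; field_simp
  have e2 : 8 / (A.ρ * A.γ k ^ 2) = 2 * A.ρ * A.root k ^ 2 := by
    rw [Params.γ_eq]; field_simp; norm_num
  have hq : 1 ≤ A.root k / A.root (k - 1) := by rwa [le_div_iff₀ hs₀, one_mul]
  have hq₂ : A.root (k + 1) / A.root k ≤ A.root k / A.root (k - 1) := by
    rw [div_le_div_iff₀ hs₁ hs₀]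
    linarith
  have e3 : 1 / (10 * A.ρ) = 1 / A.ρ / 10 := by rw [div_div, mul_comm]
  have hi : A.ρ * (1 / A.ρ) = 1 := by field_simp
  have hi0 : 0 < 1 / A.ρ := by positivity
  rw [e2, e3]
  have hpc := real_inner_le_norm (P.gradY x' y - P.gradY x y) (y' - y)
  set p := ‖P.gradY x' y - P.gradY x y‖
  set m := ‖y' - y‖
  set c := ⟪P.gradY x' y - P.gradY x y, y' - y⟫_ℝ
  set i := 1 / A.ρ
  set q := A.root k / A.root (k - 1)
  set q₂ := A.root (k + 1) / A.root k
  set s := A.root k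
  have young : ∀ r : ℝ, r * (p * m) ≤ A.ρ / 2 * r ^ 2 * p ^ 2 + i / 2 * m ^ 2 := by
    intro r
    have h := mul_nonneg hi0.le (sq_nonneg (A.ρ * r * p - m))
    have e : i * (A.ρ * r * p - m) ^ 2
        = (A.ρ * i) * A.ρ * r ^ 2 * p ^ 2 - 2 * (A.ρ * i) * r * p * m + i * m ^ 2 := by ring
    rw [e, hi] at h
    linarith
  have y1 := young 1
  have y2 : 4 * s * c ≤ 2 * A.ρ * s ^ 2 * p ^ 2 + 2 * i * m ^ 2 := by
    linarith [young s, mul_le_mul_of_nonneg_left hpc hs₁.le]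
  have I' := mul_le_mul_of_nonneg_left I (by linarith : 0 ≤ 4 * s)
  have e4 : 4 * s * (c - A.γ (k - 1) / 2 * ‖y - y₀‖ ^ 2
      + (A.γ (k - 1) - A.γ k) / 2 * (‖y'‖ ^ 2 - ‖y‖ ^ 2 - m ^ 2))
      = 4 * s * c - 2 * (s * A.γ (k - 1)) * ‖y - y₀‖ ^ 2
        + 2 * (s * A.γ (k - 1) - s * A.γ k) * (‖y'‖ ^ 2 - ‖y‖ ^ 2 - m ^ 2) := by ring
  rw [e4, e0, e1] at I'
  have t1 : 0 ≤ 4 * i * ((q - q₂) * (P.σy ^ 2 - ‖y'‖ ^ 2)) :=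
    mul_nonneg (by linarith) (mul_nonneg (by linarith) (by linarith))
  have t2 : 0 ≤ (A.γ (k - 1) - A.γ k) / 2 * (P.σy ^ 2 - ‖y'‖ ^ 2) :=
    mul_nonneg (by linarith) (by linarith)
  have t3 : 0 ≤ 4 * i * ((q - 1) * ‖y - y₀‖ ^ 2) :=
    mul_nonneg (by linarith) (mul_nonneg (by linarith) (sq_nonneg _))
  have t4 : 0 ≤ 4 * i * ((q - 1) * m ^ 2) :=
    mul_nonneg (by linarith) (mul_nonneg (by linarith) (sq_nonneg _))
  have t5 : 0 ≤ A.γ (k - 1) * ‖y - y₀‖ ^ 2 := by positivity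
  have t6 : 0 ≤ A.γ k * m ^ 2 := by positivity
  have t7 : 0 ≤ (A.γ (k - 1) - A.γ k) * m ^ 2 := mul_nonneg (by linarith) (sq_nonneg _)
  have t8 : 0 ≤ 2 * i * ((1 / 5 - (A.root (k + 1) - s)) * m ^ 2) :=
    mul_nonneg (by linarith) (mul_nonneg (by linarith) (sq_nonneg _))
  linarith

/-- Decrease of `F` in `x` along the retraction of a fraction of the proximal direction. -/
lemma F_trial_sub_le (hP : P.Standing Lx Ly Lh) {R : E₁ → E₁ → E₁} (hR : IsRetraction P.M R)
    {M₁ M₂ : ℝ} (hM : RetractionBounds P.M R M₁ M₂) {β : ℝ} (hβ : 0 < β) {x : E₁} (hx : x ∈ P.M)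
    {y : E₂} (hy : y ∈ P.S) {α : ℝ} (hα : 0 < α) (hα1 : α ≤ 1) :
    P.F (R x (α • P.proxDir β x y)) y - P.F x y
      ≤ -(α * β * ‖P.proxDir β x y‖ ^ 2)
        + α ^ 2 * (M₂ * (Lh + P.gradBound) + M₁ ^ 2 * Lx / 2) * ‖P.proxDir β x y‖ ^ 2 := by
  have hv := (hP.proxDir_spec hβ x y).1
  have hopt := hP.proxDir_variational hβ x y (w := 0) (Submodule.zero_mem _)
  set v := P.proxDir β x y
  have hαv : α • v ∈ tangentSpaceAt P.M x := Submodule.smul_mem _ _ hv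
  obtain ⟨b1, b2⟩ := hM.2.2 x hx _ hαv
  have hx' := hR.maps_to x hx _ hαv
  set x' := R x (α • v)
  have hLx := hP.Lx_pos
  have hLh := hP.Lh_nonneg
  have hdesc := le_of_gradient_lipschitz_segment (hP.hasGradientAt_gradX y) (L := Lx) (a := x)
    (b := x') (by
      intro t ht
      have hmem : x + t • (x' - x) ∈ convexHull ℝ P.M :=
        (convex_convexHull ℝ P.M).add_smul_mem (subset_convexHull ℝ _ hx)
          (by simpa using subset_convexHull ℝ _ hx') ht
      have := hP.lip_x _ hmem x (subset_convexHull ℝ _ hx) y hy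
      rwa [add_sub_cancel_left x (t • _), norm_smul, Real.norm_of_nonneg ht.1] at this)
  rw [norm_smul, Real.norm_of_nonneg hα.le] at b1 b2
  have i1 : ⟪P.gradX x y, x' - x⟫_ℝ
      ≤ α * ⟪P.gradX x y, v⟫_ℝ + P.gradBound * (M₂ * (α * ‖v‖) ^ 2) := by
    have h1 := real_inner_le_norm (P.gradX x y) (x' - (x + α • v))
    have h2 : ‖P.gradX x y‖ * ‖x' - (x + α • v)‖ ≤ P.gradBound * (M₂ * (α * ‖v‖) ^ 2) :=
      mul_le_mul (hP.norm_gradX_le hx hy) b2 (norm_nonneg _) hP.gradBound_nonneg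
    have e : x' - (x + α • v) = (x' - x) - α • v := by abel
    rw [e, inner_sub_right, inner_smul_right, ← e] at h1
    linarith
  have i2 : ‖x' - x‖ ^ 2 ≤ M₁ ^ 2 * (α * ‖v‖) ^ 2 := by
    rw [← mul_pow]
    exact pow_le_pow_left₀ (norm_nonneg _) b1 2
  have i3 : P.h x' ≤ P.h (x + α • v) + Lh * (M₂ * (α * ‖v‖) ^ 2) := by
    have h1 := le_of_abs_le (hP.lip_h x' (x + α • v))
    have h2 := mul_le_mul_of_nonneg_left b2 hLh
    linarith
  have i4 : P.h (x + α • v) ≤ P.h x + α * (P.h (x + v) - P.h x) := by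
    have h1 := hP.h_convex.2 (Set.mem_univ x) (Set.mem_univ (x + v)) (sub_nonneg.2 hα1) hα.le
      (by ring)
    rw [show (1 - α) • x + α • (x + v) = x + α • v by module, smul_eq_mul, smul_eq_mul] at h1
    linarith
  have i5 : ⟪P.gradX x y, v⟫_ℝ + (P.h (x + v) - P.h x) ≤ -(β * ‖v‖ ^ 2) := by
    simp only [inner_zero_right, add_zero, zero_sub, inner_neg_right,
      real_inner_self_eq_norm_sq] at hopt
    linarith
  have i6 := mul_le_mul_of_nonneg_left i5 hα.le
  have i7 := mul_le_mul_of_nonneg_left i2 (by linarith : 0 ≤ Lx / 2)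
  simp only [F]
  nlinarith

lemma b₁_nonneg (hP : P.Standing Lx Ly Lh) (hA : A.Admissible Ly) {R : E₁ → E₁ → E₁}
    {M₁ M₂ : ℝ} (hM : RetractionBounds P.M R M₁ M₂) : 0 ≤ P.b₁ A Lx Ly Lh M₁ M₂ := by
  have := hM.2.1
  have := hP.Lh_nonneg
  have := hP.gradBound_nonneg
  have := hP.Lx_pos
  have := hA.ρ_pos
  rw [b₁]
  positivity

/-- The line search test holds for every step `η^j` below the threshold of `J₂`. -/
lemma accept_of_pow_le (hP : P.Standing Lx Ly Lh) (hA : A.Admissible Ly)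
    {R : E₁ → E₁ → E₁} (hR : IsRetraction P.M R) {M₁ M₂ : ℝ}
    (hM : RetractionBounds P.M R M₁ M₂) {k : ℤ} (hk : 0 ≤ k) {lk : ℝ} (hl : A.lmin ≤ lk)
    {x : E₁} (hx : x ∈ P.M) {y₀ y : E₂} (hy₀ : y₀ ∈ P.S) (hy : y = P.yhat A (k - 1) y₀ x)
    {j : ℕ} (hj : A.η ^ j * (A.ρ * P.b₁ A Lx Ly Lh M₁ M₂ * A.γ (-1) ^ 2 + 8 * Ly ^ 2 * M₁ ^ 2)
      ≤ A.ρ * (1 - A.c₁) * A.lmin) :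
    P.Accept R A k (lk / A.γ k ^ 2) y₀ x y j := by
  have hyS : y ∈ P.S := hy ▸ (hP.yhat_spec A (k - 1) hy₀ x).1
  have hρ := hA.ρ_pos
  have hγ := hA.γ_pos (k := k) (by omega)
  have hlk : 0 < lk := hA.lmin_pos.trans_le hl
  have hβ : 0 < lk / A.γ k ^ 2 := by positivity
  have hα : 0 < A.η ^ j := pow_pos hA.η_pos j
  have hα1 : A.η ^ j ≤ 1 := pow_le_one₀ hA.η_pos.le hA.η_lt.le
  have hv := (hP.proxDir_spec hβ x y).1
  have hprim := hP.F_trial_sub_le hR hM hβ hx hyS hα hα1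
  rw [Accept, trial]
  set v := P.proxDir (lk / A.γ k ^ 2) x y
  have hαv : A.η ^ j • v ∈ tangentSpaceAt P.M x := Submodule.smul_mem _ _ hv
  have b1 := (hM.2.2 x hx _ hαv).1
  have hx' := hR.maps_to x hx _ hαv
  have hdual := hP.calF_sub_le hA hk hx hy₀ hy (x' := R x (A.η ^ j • v)) rfl
  set x' := R x (A.η ^ j • v)
  set α := A.η ^ j
  rw [norm_smul, Real.norm_of_nonneg hα.le] at b1
  have hp : ‖P.gradY x' y - P.gradY x y‖ ^ 2 ≤ Ly ^ 2 * (M₁ ^ 2 * (α ^ 2 * ‖v‖ ^ 2)) := by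
    have h1 := hP.norm_gradY_sub_le' hP.lip_y hx' hx hyS
    have h2 := h1.trans (mul_le_mul_of_nonneg_left b1 hP.Ly_pos.le)
    have h3 := pow_le_pow_left₀ (norm_nonneg _) h2 2
    calc _ ≤ _ := h3
      _ = _ := by ring
  have hp' := mul_le_mul_of_nonneg_left hp
    (by positivity : 0 ≤ A.ρ / 2 + 8 / (A.ρ * A.γ k ^ 2))
  have hb0 := hP.b₁_nonneg hA hM
  -- the threshold, divided by `ρ γ_k²`
  have hthr : α * (P.b₁ A Lx Ly Lh M₁ M₂ + 8 / (A.ρ * A.γ k ^ 2) * (Ly ^ 2 * M₁ ^ 2))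
      ≤ (1 - A.c₁) * (lk / A.γ k ^ 2) := by
    have e : α * (P.b₁ A Lx Ly Lh M₁ M₂ + 8 / (A.ρ * A.γ k ^ 2) * (Ly ^ 2 * M₁ ^ 2))
        = α * (A.ρ * P.b₁ A Lx Ly Lh M₁ M₂ * A.γ k ^ 2 + 8 * Ly ^ 2 * M₁ ^ 2)
          / (A.ρ * A.γ k ^ 2) := by field_simp
    rw [e, div_le_iff₀ (by positivity)]
    have e' : (1 - A.c₁) * (lk / A.γ k ^ 2) * (A.ρ * A.γ k ^ 2) = A.ρ * (1 - A.c₁) * lk := by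
      field_simp
    rw [e']
    have h1 : A.γ k ^ 2 ≤ A.γ (-1) ^ 2 :=
      pow_le_pow_left₀ hγ.le (hA.γ_anti le_rfl (by omega)) 2
    have h2 : A.ρ * P.b₁ A Lx Ly Lh M₁ M₂ * A.γ k ^ 2
        ≤ A.ρ * P.b₁ A Lx Ly Lh M₁ M₂ * A.γ (-1) ^ 2 :=
      mul_le_mul_of_nonneg_left h1 (by positivity)
    have h3 := mul_le_mul_of_nonneg_left (add_le_add_left h2 (8 * Ly ^ 2 * M₁ ^ 2)) hα.le
    have h4 : A.ρ * (1 - A.c₁) * A.lmin ≤ A.ρ * (1 - A.c₁) * lk :=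
      mul_le_mul_of_nonneg_left hl (mul_nonneg hρ.le (by linarith [hA.c₁_lt]))
    linarith
  have hthr' := mul_le_mul_of_nonneg_left hthr (by positivity : 0 ≤ α * ‖v‖ ^ 2)
  rw [b₁] at hthr'
  linarith

end Problem.Standing

/-! ### Runs of the algorithm -/

/-- Sum rule: a vector satisfying the variational inequality of `g` on `C` splits into a subgradient
of `g` and a normal vector of `C`. -/
lemma exists_eq_subgradient_add_normal {E : Type*} [NormedAddCommGroup E] [InnerProductSpace ℝ E]
    [FiniteDimensional ℝ E] {g : E → ℝ} (hg : ConvexOn ℝ Set.univ g) {C : Set E}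
    (hC : Convex ℝ C) {y c : E} (hy : y ∈ C) (h : ∀ w ∈ C, ⟪c, w - y⟫_ℝ ≤ g w - g y) :
    ∃ a ∈ subdiff g y, ∃ b ∈ normalCone C y, c = a + b := by
  obtain ⟨a, ha, hb⟩ := exists_subgradient_of_isMinOn (φ := fun z => g z - ⟪c, z⟫_ℝ)
    (hg.sub ((innerₛₗ ℝ c).concaveOn convex_univ)) hC hy (fun w hw => by
      have := h w hw
      rw [inner_sub_right] at this
      linarith)
  refine ⟨a + c, fun w => ?_, -a, hb, by abel⟩
  have := ha w
  rw [inner_add_left, inner_sub_right c]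
  linarith

namespace Problem.Standing

variable {E₁ E₂ : Type*} [NormedAddCommGroup E₁] [InnerProductSpace ℝ E₁] [FiniteDimensional ℝ E₁]
  [NormedAddCommGroup E₂] [InnerProductSpace ℝ E₂] [FiniteDimensional ℝ E₂]
  {P : Problem E₁ E₂} {Lx Ly Lh : ℝ} {A : Params}

/-- After `J₂` backtracking steps the step is below the threshold of the line search. -/
lemma pow_J₂_mul_le (hP : P.Standing Lx Ly Lh) (hA : A.Admissible Ly) {R : E₁ → E₁ → E₁}
    {M₁ M₂ : ℝ} (hM : RetractionBounds P.M R M₁ M₂) :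
    A.η ^ P.J₂ A Lx Ly Lh M₁ M₂
      * (A.ρ * P.b₁ A Lx Ly Lh M₁ M₂ * A.γ (-1) ^ 2 + 8 * Ly ^ 2 * M₁ ^ 2)
      ≤ A.ρ * (1 - A.c₁) * A.lmin := by
  have hb := hP.b₁_nonneg hA hM
  have hLy := hP.Ly_pos
  have hM₁ := hM.1
  have hρ := hA.ρ_pos
  have hc : 0 < 1 - A.c₁ := by linarith [hA.c₁_lt]
  have hl := hA.lmin_pos
  have hden : 0 < A.ρ * P.b₁ A Lx Ly Lh M₁ M₂ * A.γ (-1) ^ 2 + 8 * Ly ^ 2 * M₁ ^ 2 := by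
    positivity
  rw [← le_div_iff₀ hden, J₂]
  set thr := A.ρ * (1 - A.c₁) * A.lmin /
    (A.ρ * P.b₁ A Lx Ly Lh M₁ M₂ * A.γ (-1) ^ 2 + 8 * Ly ^ 2 * M₁ ^ 2)
  have hthr : 0 < thr := by positivity
  calc A.η ^ ⌈Real.logb A.η thr⌉₊ = A.η ^ ((⌈Real.logb A.η thr⌉₊ : ℕ) : ℝ) :=
        (Real.rpow_natCast _ _).symm
    _ ≤ A.η ^ Real.logb A.η thr :=
        Real.rpow_le_rpow_of_exponent_ge hA.η_pos hA.η_lt.le (Nat.le_ceil _)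
    _ = thr := Real.rpow_logb hA.η_pos hA.η_lt.ne hthr

lemma exists_isLeast_accept (hP : P.Standing Lx Ly Lh) (hA : A.Admissible Ly)
    {R : E₁ → E₁ → E₁} (hR : IsRetraction P.M R) {M₁ M₂ : ℝ}
    (hM : RetractionBounds P.M R M₁ M₂) {k : ℤ} (hk : 0 ≤ k) {lk : ℝ} (hl : A.lmin ≤ lk)
    {x : E₁} (hx : x ∈ P.M) {y₀ y : E₂} (hy₀ : y₀ ∈ P.S) (hy : y = P.yhat A (k - 1) y₀ x) :
    ∃ j, IsLeast {i | P.Accept R A k (lk / A.γ k ^ 2) y₀ x y i} j :=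
  ⟨_, Nat.sInf_mem (s := {i | P.Accept R A k (lk / A.γ k ^ 2) y₀ x y i})
    ⟨_, hP.accept_of_pow_le hA hR hM hk hl hx hy₀ hy (hP.pow_J₂_mul_le hA hM)⟩,
    fun _ hi => Nat.sInf_le hi⟩

lemma trial_mem (hP : P.Standing Lx Ly Lh) {R : E₁ → E₁ → E₁} (hR : IsRetraction P.M R)
    {β : ℝ} (hβ : 0 < β) {x : E₁} (hx : x ∈ P.M) (y : E₂) (j : ℕ) :
    P.trial R A β x y j ∈ P.M :=
  hR.maps_to x hx _ (Submodule.smul_mem _ _ (hP.proxDir_spec hβ x y).1)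

lemma β_pos (hA : A.Admissible Ly) {l : ℕ → ℝ} (hl : ∀ k, l k ∈ Set.Icc A.lmin A.lmax) (k : ℕ) :
    0 < A.β l k := by
  have h1 := hA.γ_pos (k := (k : ℤ)) (by omega)
  have h2 := hA.lmin_pos.trans_le (hl k).1
  rw [Params.β]
  positivity

/-- The algorithm never gets stuck. The recursion carries the triple `(x_k, y_{k-1}, y_k)`. -/
lemma exists_isRun (hP : P.Standing Lx Ly Lh) (hA : A.Admissible Ly)
    {R : E₁ → E₁ → E₁} (hR : IsRetraction P.M R) {l : ℕ → ℝ}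
    (hl : ∀ k, l k ∈ Set.Icc A.lmin A.lmax) {x₀ : E₁} (hx₀ : x₀ ∈ P.M) {y₀ : E₂} (hy₀ : y₀ ∈ P.S) :
    ∃ (x : ℕ → E₁) (y : ℤ → E₂), P.IsRun R A l x y ∧ x 0 = x₀ ∧ y (-1) = y₀ := by
  obtain ⟨M₁, M₂, hM⟩ := hR.exists_bounds hP.compact_M
  let J : ℕ → E₁ × E₂ × E₂ → ℕ := fun k s =>
    sInf {i | P.Accept R A k (A.β l k) s.2.1 s.1 s.2.2 i}
  let X : ℕ → E₁ × E₂ × E₂ → E₁ := fun k s => P.trial R A (A.β l k) s.1 s.2.2 (J k s)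
  let st : ℕ → E₁ × E₂ × E₂ := fun n => Nat.rec (x₀, y₀, P.yhat A (-1) y₀ x₀)
    (fun k s => (X k s, s.2.2, P.yhat A k s.2.2 (X k s))) n
  have hst : ∀ k, st (k + 1) = (X k (st k), (st k).2.2, P.yhat A k (st k).2.2 (X k (st k))) :=
    fun k => rfl
  have hinv : ∀ k : ℕ, (st k).1 ∈ P.M ∧ (st k).2.1 ∈ P.S ∧
      (st k).2.2 = P.yhat A ((k : ℤ) - 1) (st k).2.1 (st k).1 := by
    intro k
    induction k with
    | zero => exact ⟨hx₀, hy₀, by simp [st]⟩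
    | succ k ih =>
      obtain ⟨h1, h2, h3⟩ := ih
      rw [hst]
      refine ⟨hP.trial_mem hR (β_pos hA hl k) h1 _ _, ?_, ?_⟩
      · rw [h3]
        exact (hP.yhat_spec A _ h2 _).1
      · push_cast
        rw [add_sub_cancel_right]
  let y : ℤ → E₂ := fun m => if m < 0 then y₀ else (st m.toNat).2.2
  have hy : ∀ k : ℕ, y k = (st k).2.2 := fun k => by simp [y]
  have hyp : ∀ k : ℕ, y ((k : ℤ) - 1) = (st k).2.1 := by
    intro k
    cases k with
    | zero => simp [y, st]
    | succ k =>
      push_cast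
      rw [add_sub_cancel_right, hy, hst]
  refine ⟨fun k => (st k).1, y, ⟨hl, hx₀, by simpa [y] using hy₀, by simp [y, st], fun k => ?_⟩,
    rfl, by simp [y]⟩
  obtain ⟨h1, h2, h3⟩ := hinv k
  obtain ⟨j, hj⟩ := hP.exists_isLeast_accept hA hR hM (k := k) (by omega) (hl k).1 h1 h2 h3
  refine ⟨J k (st k), ?_, rfl, ?_⟩
  · rw [hy, hyp]
    exact ⟨Nat.sInf_mem ⟨j, hj.1⟩, fun _ hi => Nat.sInf_le hi⟩
  · have := hy (k + 1)
    push_cast at this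
    rw [this, hy]

section Run

variable {R : E₁ → E₁ → E₁} {l : ℕ → ℝ} {x : ℕ → E₁} {y : ℤ → E₂}

lemma run_mem (hP : P.Standing Lx Ly Lh) (hA : A.Admissible Ly) (hR : IsRetraction P.M R)
    (hrun : P.IsRun R A l x y) (k : ℕ) :
    x k ∈ P.M ∧ y ((k : ℤ) - 1) ∈ P.S ∧ y k = P.yhat A ((k : ℤ) - 1) (y ((k : ℤ) - 1)) (x k) := by
  induction k with
  | zero => simpa using ⟨hrun.x_zero_mem, hrun.y_neg_one_mem, hrun.y_zero⟩
  | succ k ih =>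
    obtain ⟨h1, h2, h3⟩ := ih
    obtain ⟨j, -, hx, hy⟩ := hrun.step k
    push_cast
    rw [add_sub_cancel_right]
    refine ⟨?_, ?_, hy⟩
    · rw [hx]
      exact hP.trial_mem hR (β_pos hA hrun.l_mem k) h1 _ _
    · rw [h3]
      exact (hP.yhat_spec A _ h2 _).1

lemma run_y_mem (hP : P.Standing Lx Ly Lh) (hA : A.Admissible Ly) (hR : IsRetraction P.M R)
    (hrun : P.IsRun R A l x y) (k : ℕ) : y k ∈ P.S := by
  obtain ⟨-, h2, h3⟩ := hP.run_mem hA hR hrun k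
  rw [h3]
  exact (hP.yhat_spec A _ h2 _).1

/-- Decrease of the potential in one iteration, with the accepted step bounded below by
`η^{J₂}`. -/
lemma run_decrease (hP : P.Standing Lx Ly Lh) (hA : A.Admissible Ly) (hR : IsRetraction P.M R)
    {M₁ M₂ : ℝ} (hM : RetractionBounds P.M R M₁ M₂) (hrun : P.IsRun R A l x y) (k : ℕ) :
    A.c₁ * A.η ^ P.J₂ A Lx Ly Lh M₁ M₂ * A.β l k * ‖P.proxDir (A.β l k) (x k) (y k)‖ ^ 2
        + 1 / (10 * A.ρ) * ‖y ((k : ℤ) + 1) - y k‖ ^ 2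
      ≤ P.calF A k (y ((k : ℤ) - 1)) (x k) (y k)
        - P.calF A ((k : ℤ) + 1) (y k) (x (k + 1)) (y ((k : ℤ) + 1)) := by
  obtain ⟨h1, h2, h3⟩ := hP.run_mem hA hR hrun k
  obtain ⟨j, hj, hx, hy⟩ := hrun.step k
  have hle : j ≤ P.J₂ A Lx Ly Lh M₁ M₂ := hj.2
    (hP.accept_of_pow_le hA hR hM (by omega) (hrun.l_mem k).1 h1 h2 h3 (hP.pow_J₂_mul_le hA hM))
  have hacc : P.Accept R A k (A.β l k) (y ((k : ℤ) - 1)) (x k) (y k) j := hj.1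
  rw [Accept, ← hx, ← hy] at hacc
  have hβ := β_pos hA hrun.l_mem k
  have hpow : A.η ^ P.J₂ A Lx Ly Lh M₁ M₂ ≤ A.η ^ j :=
    pow_le_pow_of_le_one hA.η_pos.le hA.η_lt.le hle
  have := mul_le_mul_of_nonneg_left hpow (by have := hA.c₁_pos; positivity :
    0 ≤ A.c₁ * A.β l k * ‖P.proxDir (A.β l k) (x k) (y k)‖ ^ 2)
  linarith

lemma calF_zero_le (hP : P.Standing Lx Ly Lh) (hA : A.Admissible Ly) {x : E₁} (hx : x ∈ P.M)
    {y₀ y : E₂} (hy₀ : y₀ ∈ P.S) (hy : y ∈ P.S) : P.calF A 0 y₀ x y ≤ P.Fupper A := by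
  have hb : BddAbove ((fun p : E₁ × E₂ => P.F p.1 p.2 +
    (6 / A.ρ + 16 / (A.ρ ^ 2 * A.γ 0) + 4 * A.γ (-1) / (A.ρ * A.γ 0) + A.γ (-1) / 2)
      * P.σy ^ 2) '' (P.M ×ˢ P.S)) :=
    ((hP.compact_M.prod hP.compact_S).image (hP.continuous_F.add continuous_const)).bddAbove
  refine le_trans ?_ (le_csSup hb ⟨(x, y), ⟨hx, hy⟩, rfl⟩)
  rw [P.calF_eq hA le_rfl, zero_sub]
  have hρ := hA.ρ_pos
  have e1 : 16 / (A.ρ ^ 2 * A.γ 0) = 8 * (1 / A.ρ) * A.root 0 := by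
    have := hA.four_div_γ (k := 0) (by omega)
    have e : 16 / (A.ρ ^ 2 * A.γ 0) = 4 * (4 / (A.ρ ^ 2 * A.γ 0)) := by ring
    rw [e, this]; ring
  have e2 : 4 * A.γ (-1) / (A.ρ * A.γ 0) = 4 * (1 / A.ρ) * (A.root 0 / A.root (-1)) := by
    rw [← hA.γ_div_γ le_rfl (by omega)]
    have := hA.γ_pos (k := 0) (by omega)
    field_simp
  have e3 : 6 / A.ρ = 6 * (1 / A.ρ) := by ring
  rw [e1, e2, e3]
  have hγ := hA.γ_pos (k := -1) le_rfl
  have hr := hA.root_pos (k := 0) (by omega)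
  have hq : 1 ≤ A.root 0 / A.root (-1) := by
    rw [le_div_iff₀ (hA.root_pos le_rfl), one_mul]
    exact hA.root_mono le_rfl (by omega)
  have hi : 0 < 1 / A.ρ := by positivity
  have hd : ‖y - y₀‖ ^ 2 ≤ 4 * P.σy ^ 2 := by
    have := pow_le_pow_left₀ (norm_nonneg _) (hP.norm_sub_le_two_σy hy hy₀) 2
    linarith
  set i := 1 / A.ρ
  set q := A.root 0 / A.root (-1)
  have t1 : 0 ≤ A.γ (-1) / 2 * ‖y‖ ^ 2 := by positivity
  have t2 : 0 ≤ 4 * i * (q - 1) * ‖y‖ ^ 2 :=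
    mul_nonneg (mul_nonneg (by linarith) (by linarith)) (sq_nonneg _)
  have t3 := mul_le_mul_of_nonneg_left hd (by positivity : 0 ≤ i / 2)
  have t4 := mul_le_mul_of_nonneg_left hd (by positivity : 0 ≤ 2 * i * A.root 0)
  have t5 : 0 ≤ i * ‖y - y₀‖ ^ 2 := by positivity
  have t6 : 0 ≤ i * P.σy ^ 2 := by positivity
  linarith

lemma Flower_le_calF (hP : P.Standing Lx Ly Lh) (hA : A.Admissible Ly) {k : ℤ} (hk : 0 ≤ k)
    {x : E₁} (hx : x ∈ P.M) {y₀ y : E₂} (hy : y ∈ P.S) :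
    P.Flower A ≤ P.calF A k y₀ x y := by
  have hb : BddBelow ((fun p : E₁ × E₂ => P.F p.1 p.2 -
    (A.γ (-1) / 2 + 24 / A.ρ) * P.σy ^ 2) '' (P.M ×ˢ P.S)) :=
    ((hP.compact_M.prod hP.compact_S).image (hP.continuous_F.sub continuous_const)).bddBelow
  refine (csInf_le hb ⟨(x, y), ⟨hx, hy⟩, rfl⟩).trans ?_
  rw [P.calF_eq hA hk]
  have hρ := hA.ρ_pos
  have hγ := hA.γ_pos (k := k - 1) (by omega)
  have hγ' := hA.γ_anti (j := -1) (k := k - 1) le_rfl (by omega)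
  have hr := hA.two_lt_root (k := k) (by omega)
  have hY : ‖y‖ ^ 2 ≤ P.σy ^ 2 := pow_le_pow_left₀ (norm_nonneg _) (hP.norm_le_σy hy) 2
  have hr0 := hA.root_pos (k := k - 1) (by omega)
  have hr1 := hA.root_pos (k := k) (by omega)
  have hi : 0 < 1 / A.ρ := by positivity
  have hq : 0 < A.root k / A.root (k - 1) := by positivity
  have e3 : 24 / A.ρ = 24 * (1 / A.ρ) := by ring
  rw [e3]
  set i := 1 / A.ρ
  set q := A.root k / A.root (k - 1)
  have t1 : 0 ≤ 4 * i * (q * (P.σy ^ 2 - ‖y‖ ^ 2)) :=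
    mul_nonneg (by linarith) (mul_nonneg hq.le (by linarith))
  have t2 := mul_le_mul_of_nonneg_left hY (half_pos hγ).le
  have t3 : 0 ≤ i / 2 * ‖y - y₀‖ ^ 2 := by positivity
  have t4 : 0 ≤ 2 * i * (A.root k - 2) * ‖y - y₀‖ ^ 2 :=
    mul_nonneg (mul_nonneg (by linarith) (by linarith)) (sq_nonneg _)
  have t5 : 0 ≤ i * P.σy ^ 2 := by positivity
  have t6 : 0 ≤ 4 * i * ‖y‖ ^ 2 := by positivity
  have t7 : 0 ≤ A.γ (-1) / 2 * P.σy ^ 2 := by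
    have := hγ.trans_le hγ'
    positivity
  linarith

/-- The range of the potential dominates the diameter of `S`; this makes up for the slowly
decaying regularization. -/
lemma σy_sq_le_gap (hP : P.Standing Lx Ly Lh) (hA : A.Admissible Ly) {x : E₁} (hx : x ∈ P.M)
    {y : E₂} (hy : y ∈ P.S) : 46 / A.ρ * P.σy ^ 2 ≤ P.Fupper A - P.Flower A := by
  have hbu : BddAbove ((fun p : E₁ × E₂ => P.F p.1 p.2 +
    (6 / A.ρ + 16 / (A.ρ ^ 2 * A.γ 0) + 4 * A.γ (-1) / (A.ρ * A.γ 0) + A.γ (-1) / 2)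
      * P.σy ^ 2) '' (P.M ×ˢ P.S)) :=
    ((hP.compact_M.prod hP.compact_S).image (hP.continuous_F.add continuous_const)).bddAbove
  have hbl : BddBelow ((fun p : E₁ × E₂ => P.F p.1 p.2 -
    (A.γ (-1) / 2 + 24 / A.ρ) * P.σy ^ 2) '' (P.M ×ˢ P.S)) :=
    ((hP.compact_M.prod hP.compact_S).image (hP.continuous_F.sub continuous_const)).bddBelow
  have h1 := le_csSup hbu ⟨(x, y), ⟨hx, hy⟩, rfl⟩
  have h2 := csInf_le hbl ⟨(x, y), ⟨hx, hy⟩, rfl⟩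
  have hρ := hA.ρ_pos
  have hγ := hA.γ_pos (k := -1) le_rfl
  have hγ0 := hA.γ_pos (k := 0) (by omega)
  have e1 : 16 / (A.ρ ^ 2 * A.γ 0) = 8 * (1 / A.ρ) * A.root 0 := by
    have := hA.four_div_γ (k := 0) (by omega)
    have e : 16 / (A.ρ ^ 2 * A.γ 0) = 4 * (4 / (A.ρ ^ 2 * A.γ 0)) := by ring
    rw [e, this]; ring
  have hr := hA.two_lt_root (k := 0) (by omega)
  have hi : 0 < 1 / A.ρ := by positivity
  have t1 : 0 ≤ 4 * A.γ (-1) / (A.ρ * A.γ 0) * P.σy ^ 2 := by positivity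
  have t2 : 0 ≤ A.γ (-1) / 2 * P.σy ^ 2 := by positivity
  have t3 : 0 ≤ 8 * (1 / A.ρ) * (A.root 0 - 2) * P.σy ^ 2 :=
    mul_nonneg (mul_nonneg (by linarith) (by linarith)) (sq_nonneg _)
  rw [Fupper, Flower]
  rw [e1] at h1 ⊢
  have e2 : 46 / A.ρ * P.σy ^ 2 = 46 * (1 / A.ρ * P.σy ^ 2) := by ring
  have e3 : 24 / A.ρ = 24 * (1 / A.ρ) := by ring
  have e4 : 6 / A.ρ = 6 * (1 / A.ρ) := by ring
  rw [e2]
  rw [e3] at h2 ⊢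
  rw [e4] at h1 ⊢
  linarith

/-- Telescoping the decrease of the potential. -/
lemma run_sum_le (hP : P.Standing Lx Ly Lh) (hA : A.Admissible Ly) (hR : IsRetraction P.M R)
    {M₁ M₂ : ℝ} (hM : RetractionBounds P.M R M₁ M₂) (hrun : P.IsRun R A l x y) (N : ℕ) :
    ∑ k ∈ Finset.range N, (A.c₁ * A.η ^ P.J₂ A Lx Ly Lh M₁ M₂ * A.β l k
        * ‖P.proxDir (A.β l k) (x k) (y k)‖ ^ 2
        + 1 / (10 * A.ρ) * ‖y ((k : ℤ) + 1) - y k‖ ^ 2)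
      ≤ P.Fupper A - P.Flower A := by
  let V : ℕ → ℝ := fun k => P.calF A k (y ((k : ℤ) - 1)) (x k) (y k)
  have hV : ∀ k : ℕ, P.calF A ((k : ℤ) + 1) (y k) (x (k + 1)) (y ((k : ℤ) + 1)) = V (k + 1) := by
    intro k
    simp only [V]
    push_cast
    rw [add_sub_cancel_right]
  have h0 : V 0 ≤ P.Fupper A := by
    obtain ⟨h1, h2, -⟩ := hP.run_mem hA hR hrun 0
    exact hP.calF_zero_le hA h1 h2 (hP.run_y_mem hA hR hrun 0)
  have hN : P.Flower A ≤ V N :=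
    hP.Flower_le_calF hA (by omega) (hP.run_mem hA hR hrun N).1 (hP.run_y_mem hA hR hrun N)
  calc _ ≤ ∑ k ∈ Finset.range N, (V k - V (k + 1)) := by
        refine Finset.sum_le_sum fun k _ => ?_
        rw [← hV]
        exact hP.run_decrease hA hR hM hrun k
    _ = V 0 - V N := Finset.sum_range_sub' V N
    _ ≤ _ := by linarith

/-- The dual residual at `(x_k, y_k)` in terms of the last dual step, from the optimality condition
that defines `y_k`. -/
lemma run_infEDist_le (hP : P.Standing Lx Ly Lh) (hA : A.Admissible Ly) (hR : IsRetraction P.M R)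
    (hrun : P.IsRun R A l x y) (k : ℕ) :
    Metric.infEDist 0 (P.dualResidual (x k) (y k))
      ≤ ENNReal.ofReal ((A.ρ * Ly + 1) * (‖y k - y ((k : ℤ) - 1)‖ / A.ρ)
        + 2 * P.σy / A.ρ / A.root ((k : ℤ) - 1)) := by
  obtain ⟨h1, h2, h3⟩ := hP.run_mem hA hR hrun k
  have hyS := hP.run_y_mem hA hR hrun k
  have hV := fun w (hw : w ∈ P.S) => hP.yhat_variational A ((k : ℤ) - 1) h2 (x k) hw
  rw [← h3] at hV
  obtain ⟨a, ha, b, hb, hab⟩ := exists_eq_subgradient_add_normal hP.g_convex hP.convex_S hyS hV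
  have hz : P.gradY (x k) (y k) - a - b ∈ P.dualResidual (x k) (y k) := ⟨a, ha, b, hb, rfl⟩
  refine (Metric.infEDist_le_edist_of_mem hz).trans ?_
  rw [edist_dist, dist_zero_left]
  refine ENNReal.ofReal_le_ofReal ?_
  have hρ := hA.ρ_pos
  have hγ := hA.γ_pos (k := (k : ℤ) - 1) (by omega)
  have hr := hA.root_pos (k := (k : ℤ) - 1) (by omega)
  have e : P.gradY (x k) (y k) - a - b = (P.gradY (x k) (y k) - P.gradY (x k) (y ((k : ℤ) - 1)))
      + (A.γ ((k : ℤ) - 1) • y ((k : ℤ) - 1) + (1 / A.ρ) • (y k - y ((k : ℤ) - 1))) := by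
    rw [sub_sub, ← hab]
    abel
  rw [e]
  refine (norm_add_le _ _).trans ((add_le_add_right (norm_add_le _ _) _).trans ?_)
  rw [norm_smul, norm_smul, Real.norm_of_nonneg hγ.le,
    Real.norm_of_nonneg (by positivity : 0 ≤ 1 / A.ρ)]
  have i1 := hP.norm_gradY_sub_le hP.lip_y h1 hyS h2
  have i2 := mul_le_mul_of_nonneg_left (hP.norm_le_σy h2) hγ.le
  have e1 : A.γ ((k : ℤ) - 1) * P.σy = 2 * P.σy / A.ρ / A.root ((k : ℤ) - 1) := by
    rw [Params.γ_eq]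
    field_simp
  have e2 : (A.ρ * Ly + 1) * (‖y k - y ((k : ℤ) - 1)‖ / A.ρ)
      = Ly * ‖y k - y ((k : ℤ) - 1)‖ + 1 / A.ρ * ‖y k - y ((k : ℤ) - 1)‖ := by
    field_simp
  rw [← e1, e2]
  linarith

end Run

end Problem.Standing

/-! ### The rate of convergence -/

lemma Problem.C₁_pos {E₁ E₂ : Type*} [NormedAddCommGroup E₁] [InnerProductSpace ℝ E₁]
    [FiniteDimensional ℝ E₁] (P : Problem E₁ E₂) {A : Params} {Lx Ly Lh : ℝ}
    (hA : A.Admissible Ly) (M₁ M₂ : ℝ) :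
    0 < P.C₁ A Lx Ly Lh M₁ M₂ := by
  have := hA.c₁_pos
  have := pow_pos hA.η_pos (P.J₂ A Lx Ly Lh M₁ M₂)
  have := hA.ρ_pos
  have := hA.lmin_pos.trans hA.lmin_lt
  have : 0 < A.κ + 2 := by linarith [hA.κ_gt]
  exact lt_min (by positivity) (by positivity)

/-- `C₁ ≤ ρ (κ + 2)^{1/2} / 10`, written with `root 0 = (κ + 2)^{1/4}`. -/
lemma Problem.C₁_le {E₁ E₂ : Type*} [NormedAddCommGroup E₁] [InnerProductSpace ℝ E₁]
    [FiniteDimensional ℝ E₁] (P : Problem E₁ E₂) {A : Params} {Lx Ly Lh : ℝ}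
    (hA : A.Admissible Ly) (M₁ M₂ : ℝ) :
    P.C₁ A Lx Ly Lh M₁ M₂ ≤ A.ρ * A.root 0 ^ 2 / 10 := by
  refine (min_le_right _ _).trans (le_of_eq ?_)
  have hκ := hA.κ_gt
  rw [Params.root, ← Real.rpow_natCast, ← Real.rpow_mul (by push_cast; linarith)]
  norm_num

namespace Problem.Standing

variable {E₁ E₂ : Type*} [NormedAddCommGroup E₁] [InnerProductSpace ℝ E₁] [FiniteDimensional ℝ E₁]
  [NormedAddCommGroup E₂] [InnerProductSpace ℝ E₂] [FiniteDimensional ℝ E₂]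
  {P : Problem E₁ E₂} {Lx Ly Lh : ℝ} {A : Params}
  {R : E₁ → E₁ → E₁} {l : ℕ → ℝ} {x : ℕ → E₁} {y : ℤ → E₂}

/-- The two parts of the stationarity measure are summable against the weights
`(k + κ + 2)^{-1/2}`. The first dual step is not covered by the telescoped decrease; it is bounded
by the diameter of `S`, hence the factor `2`. -/
lemma run_weighted_sum_le (hP : P.Standing Lx Ly Lh) (hA : A.Admissible Ly)
    (hR : IsRetraction P.M R) {M₁ M₂ : ℝ} (hM : RetractionBounds P.M R M₁ M₂)
    (hrun : P.IsRun R A l x y) (N : ℕ) :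
    ∑ k ∈ Finset.range N, (max ‖A.β l k • P.proxDir (A.β l k) (x k) (y k)‖
        (‖y k - y ((k : ℤ) - 1)‖ / A.ρ) / A.root k) ^ 2
      ≤ 2 * (P.Fupper A - P.Flower A) / P.C₁ A Lx Ly Lh M₁ M₂ := by
  have hC := P.C₁_pos (Lx := Lx) (Lh := Lh) hA M₁ M₂
  have hρ := hA.ρ_pos
  rw [le_div_iff₀ hC, Finset.sum_mul]
  let p : ℕ → ℝ := fun k => A.c₁ * A.η ^ P.J₂ A Lx Ly Lh M₁ M₂ * A.β l k
        * ‖P.proxDir (A.β l k) (x k) (y k)‖ ^ 2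
  let d : ℕ → ℝ := fun k => 1 / (10 * A.ρ) * ‖y k - y ((k : ℤ) - 1)‖ ^ 2
  have hd1 : ∀ k : ℕ, 1 / (10 * A.ρ) * ‖y ((k : ℤ) + 1) - y k‖ ^ 2 = d (k + 1) := by
    intro k
    simp only [d]
    push_cast
    rw [add_sub_cancel_right]
  have hd0 : ∀ k, 0 ≤ d k := fun k => by positivity
  have hp0 : ∀ k, 0 ≤ p k := fun k => by
    have := hA.c₁_pos
    have := hA.η_pos
    have := β_pos hA hrun.l_mem k
    positivity
  have hterm : ∀ k ∈ Finset.range N, (max ‖A.β l k • P.proxDir (A.β l k) (x k) (y k)‖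
        (‖y k - y ((k : ℤ) - 1)‖ / A.ρ) / A.root k) ^ 2 * P.C₁ A Lx Ly Lh M₁ M₂ ≤ p k + d k := by
    intro k _
    have hr := hA.root_pos (k := (k : ℤ)) (by omega)
    have hβ := β_pos hA hrun.l_mem k
    have hlk := hA.lmin_pos.trans_le (hrun.l_mem k).1
    have hη := pow_pos hA.η_pos (P.J₂ A Lx Ly Lh M₁ M₂)
    have hc := hA.c₁_pos
    rcases max_cases ‖A.β l k • P.proxDir (A.β l k) (x k) (y k)‖
      (‖y k - y ((k : ℤ) - 1)‖ / A.ρ) with h | h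
    · rw [h.1, norm_smul, Real.norm_of_nonneg hβ.le]
      refine le_trans ?_ (le_add_of_nonneg_right (hd0 k))
      have h1 : P.C₁ A Lx Ly Lh M₁ M₂
          ≤ 4 * A.c₁ * A.η ^ P.J₂ A Lx Ly Lh M₁ M₂ / (l k * A.ρ ^ 2) :=
        (min_le_left _ _).trans (div_le_div_of_nonneg_left (by positivity) (by positivity)
          (mul_le_mul_of_nonneg_right (hrun.l_mem k).2 (by positivity)))
      refine (mul_le_mul_of_nonneg_left h1 (sq_nonneg _)).trans (le_of_eq ?_)
      simp only [p, Params.β, Params.γ_eq]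
      field_simp
      ring
    · rw [h.1]
      refine le_trans ?_ (le_add_of_nonneg_left (hp0 k))
      have h1 : P.C₁ A Lx Ly Lh M₁ M₂ ≤ A.ρ * A.root k ^ 2 / 10 := by
        refine (P.C₁_le hA M₁ M₂).trans ?_
        have := pow_le_pow_left₀ (hA.root_pos (k := 0) (by omega)).le
          (hA.root_mono (j := 0) (k := (k : ℤ)) (by omega) (by omega)) 2
        have := mul_le_mul_of_nonneg_left this hρ.le
        linarith
      refine (mul_le_mul_of_nonneg_left h1 (sq_nonneg _)).trans (le_of_eq ?_)
      simp only [d]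
      field_simp
  refine (Finset.sum_le_sum hterm).trans ?_
  have hsum := hP.run_sum_le hA hR hM hrun N
  simp only [hd1] at hsum
  have hshift : ∑ k ∈ Finset.range N, d k ≤ ∑ k ∈ Finset.range N, d (k + 1) + d 0 := by
    rw [← Finset.sum_range_succ', Finset.sum_range_succ]
    linarith [hd0 N]
  obtain ⟨hx0, hy0, -⟩ := hP.run_mem hA hR hrun 0
  have hyS := hP.run_y_mem hA hR hrun 0
  have hgap := hP.σy_sq_le_gap hA hx0 hyS
  have hfirst : d 0 ≤ P.Fupper A - P.Flower A := by
    refine le_trans ?_ hgap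
    have h1 := pow_le_pow_left₀ (norm_nonneg _) (hP.norm_sub_le_two_σy hyS hy0) 2
    have h2 := mul_le_mul_of_nonneg_left h1 (by positivity : 0 ≤ 1 / (10 * A.ρ))
    refine h2.trans ?_
    rw [div_mul_eq_mul_div, div_mul_eq_mul_div, div_le_div_iff₀ (by positivity) hρ]
    have : 0 ≤ P.σy ^ 2 * A.ρ := by positivity
    linarith
  rw [Finset.sum_add_distrib] at hsum ⊢
  linarith

/-- The sum of `(k + κ + 1)^{-1/4}` over `k < N` is of order `N^{3/4}`, as the integral of
`t ↦ t^{-1/4}` is. -/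
lemma sum_inv_root_le (hA : A.Admissible Ly) (N : ℕ) :
    ∑ k ∈ Finset.range N, 1 / A.root ((k : ℤ) - 1) ≤ 2 * ((N : ℝ) ^ (1 / 4 : ℝ)) ^ 3 := by
  have hn : ∀ k : ℕ, ((k : ℝ) ^ (1 / 4 : ℝ)) ^ 4 = k := by
    intro k
    rw [← Real.rpow_natCast, ← Real.rpow_mul (Nat.cast_nonneg k)]
    norm_num
  have hn0 : ∀ k : ℕ, 0 ≤ (k : ℝ) ^ (1 / 4 : ℝ) := fun k => by positivity
  induction N with
  | zero => simp
  | succ N ih =>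
    rw [Finset.sum_range_succ]
    have hκ := hA.κ_gt
    have hm0 : 0 < ((N + 1 : ℕ) : ℝ) ^ (1 / 4 : ℝ) := by positivity
    have h1 : 1 / A.root ((N : ℤ) - 1) ≤ 1 / ((N + 1 : ℕ) : ℝ) ^ (1 / 4 : ℝ) := by
      refine one_div_le_one_div_of_le hm0 (Real.rpow_le_rpow (by positivity) ?_ (by norm_num))
      push_cast
      linarith
    have e1 := hn N
    have e2 := hn (N + 1)
    have e3 := hn0 N
    set n := (N : ℝ) ^ (1 / 4 : ℝ)
    set m := ((N + 1 : ℕ) : ℝ) ^ (1 / 4 : ℝ)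
    push_cast at e2
    have key : 2 * n ^ 3 + 1 / m ≤ 2 * m ^ 3 := by
      rw [← sub_nonneg]
      have e : 2 * m ^ 3 - (2 * n ^ 3 + 1 / m) = (2 * m ^ 4 - 2 * n ^ 3 * m - 1) / m := by
        field_simp
        ring
      rw [e]
      refine div_nonneg ?_ hm0.le
      -- weighted arithmetic-geometric mean inequality
      have amgm : 4 * (n ^ 3 * m) ≤ 3 * n ^ 4 + m ^ 4 := by
        nlinarith [mul_nonneg (sq_nonneg (n - m)) (sq_nonneg (n + m)), sq_nonneg (n ^ 2 - n * m),
          sq_nonneg (n ^ 2 - m ^ 2)]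
      linarith
    linarith

/-- As long as all iterates have stationarity measure at least `ε`, the iteration count obeys the
bound. The inequality `ε ≤ (ρ L_y + 1) m_k + (2 σ_y / ρ) (k + κ + 1)^{-1/4}` is averaged over all
`k < N`; the average of the second term costs a factor above `1`, which is recovered from
`(15 + 4 κ)^{1/4} > (κ + 2)^{1/4}` and from the size of the potential range. -/
lemma run_count_le (hP : P.Standing Lx Ly Lh) (hA : A.Admissible Ly)
    (hR : IsRetraction P.M R) {M₁ M₂ : ℝ} (hM : RetractionBounds P.M R M₁ M₂)
    (hrun : P.IsRun R A l x y) {ε : ℝ} (hε : 0 < ε) {N : ℕ}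
    (hN : ∀ k < N, k ∉ P.goodIndices A l x y ε) :
    (N : ℝ) ≤ ((15 + 4 * A.κ) ^ (1 / 4 : ℝ)
              * (2 * (P.Fupper A - P.Flower A) / P.C₁ A Lx Ly Lh M₁ M₂) ^ (1 / 2 : ℝ)
              * (A.ρ * Ly + 1)
            + 2 * P.σy / A.ρ) ^ 4 / ε ^ 4 := by
  have hρ := hA.ρ_pos
  have hκ := hA.κ_gt
  have hLy := hP.Ly_pos
  have hσ := hP.σy_nonneg
  rcases Nat.eq_zero_or_pos N with rfl | hNpos
  · rw [Nat.cast_zero]; positivity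
  have hN1 : (1 : ℝ) ≤ N := by exact_mod_cast hNpos
  set W := (2 * (P.Fupper A - P.Flower A) / P.C₁ A Lx Ly Lh M₁ M₂) ^ (1 / 2 : ℝ) with hW
  set Y := 2 * P.σy / A.ρ with hY
  set a := A.ρ * Ly + 1 with ha
  have ha1 : 1 ≤ a := by rw [ha]; linarith [mul_pos hρ hLy]
  have hY0 : 0 ≤ Y := by positivity
  let m : ℕ → ℝ := fun k => max ‖A.β l k • P.proxDir (A.β l k) (x k) (y k)‖
        (‖y k - y ((k : ℤ) - 1)‖ / A.ρ)
  have hm0 : ∀ k, 0 ≤ m k := fun k => le_max_of_le_left (norm_nonneg _)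
  have hC := P.C₁_pos (Lx := Lx) (Lh := Lh) hA M₁ M₂
  obtain ⟨hx0, hy0, -⟩ := hP.run_mem hA hR hrun 0
  have hgap := hP.σy_sq_le_gap hA hx0 (hP.run_y_mem hA hR hrun 0)
  have hgap0 : 0 ≤ P.Fupper A - P.Flower A := le_trans (by positivity) hgap
  have hW0 : 0 ≤ W := Real.rpow_nonneg (by positivity) _
  have hW2 : W ^ 2 = 2 * (P.Fupper A - P.Flower A) / P.C₁ A Lx Ly Lh M₁ M₂ := by
    rw [hW, ← Real.rpow_natCast, ← Real.rpow_mul (by positivity)]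
    norm_num
  -- the lower bound for the measure at each iterate
  have hlow : ∀ k ∈ Finset.range N, ε ≤ a * m k + Y * (1 / A.root ((k : ℤ) - 1)) := by
    intro k hk
    have h1 := hN k (Finset.mem_range.1 hk)
    have hr := hA.root_pos (k := (k : ℤ) - 1) (by omega)
    rw [goodIndices, Set.mem_ofPred_eq, not_lt, gameMeasure, le_max_iff] at h1
    rcases h1 with h1 | h1
    · rw [ENNReal.ofReal_le_ofReal_iff (norm_nonneg _)] at h1
      have h2 : ‖A.β l k • P.proxDir (A.β l k) (x k) (y k)‖ ≤ m k := le_max_left _ _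
      have h3 : m k ≤ a * m k := le_mul_of_one_le_left (hm0 k) ha1
      have h4 : 0 ≤ Y * (1 / A.root ((k : ℤ) - 1)) := by positivity
      linarith
    · have h2 := h1.trans (hP.run_infEDist_le hA hR hrun k)
      rw [ENNReal.ofReal_le_ofReal_iff (by positivity)] at h2
      have h3 : a * (‖y k - y ((k : ℤ) - 1)‖ / A.ρ) ≤ a * m k :=
        mul_le_mul_of_nonneg_left (le_max_right _ _) (by linarith)
      rw [mul_one_div]
      linarith
  have hsum := Finset.sum_le_sum hlow
  rw [Finset.sum_const, Finset.card_range, nsmul_eq_mul, Finset.sum_add_distrib,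
    ← Finset.mul_sum, ← Finset.mul_sum] at hsum
  have hinv := sum_inv_root_le hA N
  set n := (N : ℝ) ^ (1 / 4 : ℝ) with hn
  have hn4 : n ^ 4 = N := by
    rw [hn, ← Real.rpow_natCast, ← Real.rpow_mul (Nat.cast_nonneg N)]
    norm_num
  have hn1 : 1 ≤ n := Real.one_le_rpow hN1 (by norm_num)
  set r := A.root 0 with hr
  have hr4 : r ^ 4 = A.κ + 2 := by
    have := hA.root_pow (k := 0) (by omega)
    push_cast at this
    linarith
  have hr0 : 0 < r := hA.root_pos (by omega)
  -- Cauchy-Schwarz inequality for the first term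
  have hcs : ∑ k ∈ Finset.range N, m k ≤ n ^ 3 * r * W := by
    refine le_of_sq_le_sq ?_ (by positivity)
    have h1 := Finset.sum_mul_sq_le_sq_mul_sq (Finset.range N)
      (fun k : ℕ => A.root (k : ℤ)) (fun k => m k / A.root k)
    have e : ∑ k ∈ Finset.range N, A.root (k : ℤ) * (m k / A.root k)
        = ∑ k ∈ Finset.range N, m k :=
      Finset.sum_congr rfl fun k _ => mul_div_cancel₀ _ (hA.root_pos (by omega)).ne'
    rw [e] at h1
    have h2 : ∑ k ∈ Finset.range N, A.root (k : ℤ) ^ 2 ≤ n ^ 4 * (n ^ 2 * r ^ 2) := by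
      rw [hn4, ← nsmul_eq_mul]
      conv_rhs => rw [← Finset.card_range N]
      refine Finset.sum_le_card_nsmul _ _ _ fun k hk => ?_
      have hkN : (k : ℝ) + 1 ≤ N := by exact_mod_cast Finset.mem_range.1 hk
      refine le_of_sq_le_sq ?_ (by positivity)
      calc (A.root (k : ℤ) ^ 2) ^ 2 = A.root (k : ℤ) ^ 4 := by ring
        _ = k + A.κ + 2 := by rw [hA.root_pow (by omega)]; norm_cast
        _ ≤ N * (A.κ + 2) := by nlinarith
        _ = (n ^ 2 * r ^ 2) ^ 2 := by rw [← hn4, ← hr4]; ring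
    have h3 := hP.run_weighted_sum_le hA hR hM hrun N
    rw [← hW2] at h3
    calc _ ≤ _ := h1
      _ ≤ n ^ 4 * (n ^ 2 * r ^ 2) * W ^ 2 :=
        mul_le_mul h2 h3 (Finset.sum_nonneg fun k _ => sq_nonneg _) (by positivity)
      _ = _ := by ring
  -- `C₁ ≤ ρ r² / 10` and the size of the potential range make `r W` dominate `Y`
  have h15 : 15 * Y ≤ r * W := by
    refine le_of_sq_le_sq ?_ (by positivity)
    rw [mul_pow r, hW2, mul_div_assoc' (r ^ 2), le_div_iff₀ hC]
    have h1 : (15 * Y) ^ 2 * P.C₁ A Lx Ly Lh M₁ M₂ ≤ (15 * Y) ^ 2 * (A.ρ * r ^ 2 / 10) :=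
      mul_le_mul_of_nonneg_left (P.C₁_le hA M₁ M₂) (sq_nonneg _)
    have e1 : (15 * Y) ^ 2 * (A.ρ * r ^ 2 / 10) = r ^ 2 * (90 / A.ρ * P.σy ^ 2) := by
      rw [hY]; field_simp; ring
    have h2 : 90 / A.ρ * P.σy ^ 2 ≤ 2 * (46 / A.ρ * P.σy ^ 2) := by
      have : 0 ≤ 1 / A.ρ * P.σy ^ 2 := by positivity
      have e2 : 90 / A.ρ * P.σy ^ 2 = 90 * (1 / A.ρ * P.σy ^ 2) := by ring
      have e3 : 46 / A.ρ * P.σy ^ 2 = 46 * (1 / A.ρ * P.σy ^ 2) := by ring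
      rw [e2, e3]
      linarith
    have h3 := mul_le_mul_of_nonneg_left (h2.trans (mul_le_mul_of_nonneg_left hgap zero_le_two))
      (sq_nonneg r)
    linarith
  set q := (15 + 4 * A.κ) ^ (1 / 4 : ℝ) with hq
  have hq0 : 0 ≤ q := Real.rpow_nonneg (by linarith) _
  have hq4 : q ^ 4 = 15 + 4 * A.κ := by
    rw [hq, ← Real.rpow_natCast, ← Real.rpow_mul (by linarith)]
    norm_num
  -- `(7/5)⁴ < 4`
  have hqr : 7 / 5 * r ≤ q := by
    refine le_of_pow_le_pow_left₀ (n := 4) (by norm_num) hq0 ?_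
    rw [mul_pow, hr4, hq4]
    linarith
  have hmain : n * ε ≤ q * W * a + Y := by
    have h1 := mul_le_mul_of_nonneg_left hcs (by linarith : 0 ≤ a)
    have h2 := mul_le_mul_of_nonneg_left hinv hY0
    have h3 : n ^ 3 * (n * ε) ≤ n ^ 3 * (a * r * W + 2 * Y) := by
      rw [← hn4] at hsum
      linarith
    have h4 : n * ε ≤ a * r * W + 2 * Y := le_of_mul_le_mul_left h3 (by positivity)
    have h5 := mul_le_mul_of_nonneg_right hqr (mul_nonneg hW0 (by linarith : 0 ≤ a))
    have h6 : r * W ≤ r * W * a := le_mul_of_one_le_right (by positivity) ha1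
    linarith
  rw [le_div_iff₀ (by positivity), ← hn4, ← mul_pow]
  exact pow_le_pow_left₀ (by positivity) hmain 4

/-- The first good index exists and obeys the bound. -/
lemma run_T_le (hP : P.Standing Lx Ly Lh) (hA : A.Admissible Ly)
    (hR : IsRetraction P.M R) {M₁ M₂ : ℝ} (hM : RetractionBounds P.M R M₁ M₂)
    (hrun : P.IsRun R A l x y) {ε : ℝ} (hε : 0 < ε) :
    (P.goodIndices A l x y ε).Nonempty ∧
        (P.T A l x y ε : ℝ) ≤
          ((15 + 4 * A.κ) ^ (1 / 4 : ℝ)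
              * (2 * (P.Fupper A - P.Flower A) / P.C₁ A Lx Ly Lh M₁ M₂) ^ (1 / 2 : ℝ)
              * (A.ρ * Ly + 1)
            + 2 * P.σy / A.ρ) ^ 4 / ε ^ 4 := by
  constructor
  · by_contra hemp
    rw [Set.not_nonempty_iff_eq_empty] at hemp
    obtain ⟨N, hN⟩ := exists_nat_gt (((15 + 4 * A.κ) ^ (1 / 4 : ℝ)
              * (2 * (P.Fupper A - P.Flower A) / P.C₁ A Lx Ly Lh M₁ M₂) ^ (1 / 2 : ℝ)
              * (A.ρ * Ly + 1) + 2 * P.σy / A.ρ) ^ 4 / ε ^ 4)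
    exact absurd (hP.run_count_le hA hR hM hrun hε (N := N) (by simp [hemp])) (not_le.2 hN)
  · exact hP.run_count_le hA hR hM hrun hε fun k hk => Nat.notMem_of_lt_sInf hk

/-- One constant for all runs, with the measure `𝒢^{β_k}` strictly below `ε`. -/
lemma exists_good_bound (hP : P.Standing Lx Ly Lh) (hA : A.Admissible Ly)
    (hR : IsRetraction P.M R) : ∃ K : ℝ, 0 < K ∧
      ∀ (l : ℕ → ℝ) (x : ℕ → E₁) (y : ℤ → E₂), P.IsRun R A l x y → ∀ ε : ℝ, 0 < ε →
        ∃ k : ℕ, (k : ℝ) ≤ K / ε ^ 4 ∧ k ∈ P.goodIndices A l x y ε := by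
  obtain ⟨M₁, M₂, hM⟩ := hR.exists_bounds hP.compact_M
  refine ⟨((15 + 4 * A.κ) ^ (1 / 4 : ℝ)
              * (2 * (P.Fupper A - P.Flower A) / P.C₁ A Lx Ly Lh M₁ M₂) ^ (1 / 2 : ℝ)
              * (A.ρ * Ly + 1) + 2 * P.σy / A.ρ) ^ 4 + 1, by positivity,
    fun l x y hrun ε hε => ?_⟩
  obtain ⟨h1, h2⟩ := hP.run_T_le hA hR hM hrun hε
  refine ⟨P.T A l x y ε, h2.trans ?_, Nat.sInf_mem h1⟩
  exact div_le_div_of_nonneg_right (by linarith) (by positivity)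

lemma exists_isGameStationary_bound (hP : P.Standing Lx Ly Lh) (hA : A.Admissible Ly)
    (hR : IsRetraction P.M R) : ∃ K : ℝ, 0 < K ∧
      ∀ (l : ℕ → ℝ) (x : ℕ → E₁) (y : ℤ → E₂), P.IsRun R A l x y → ∀ ε : ℝ, 0 < ε →
        ∃ k : ℕ, (k : ℝ) ≤ K / ε ^ 4 ∧ P.IsGameStationary ε (x k) (y k) := by
  obtain ⟨K, hK, hgood⟩ := hP.exists_good_bound hA hR
  refine ⟨K, hK, fun l x y hrun ε hε => ?_⟩
  obtain ⟨k, hk, hkg⟩ := hgood l x y hrun ε hε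
  exact ⟨k, hk, (hP.run_mem hA hR hrun k).1, hP.run_y_mem hA hR hrun k,
    A.β l k, β_pos hA hrun.l_mem k, le_of_lt hkg⟩

/-! ### Optimization stationarity -/

/-- Optimality of the tangential proximal step: `-β v` is the sum of `∇_x f`, a subgradient of `h`
and a normal vector. -/
lemma proxDir_optimality (hP : P.Standing Lx Ly Lh) {β : ℝ} (hβ : 0 < β) (x : E₁) (y : E₂) :
    ∃ b ∈ subdiff P.h (x + P.proxDir β x y), ∃ n ∈ (tangentSpaceAt P.M x)ᗮ,
      P.gradX x y + b + n = -(β • P.proxDir β x y) := by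
  have hv := (hP.proxDir_spec hβ x y).1
  have hvar := fun w (hw : w ∈ tangentSpaceAt P.M x) => hP.proxDir_variational hβ x y hw
  set v := P.proxDir β x y
  obtain ⟨b, hb, n, hn, e⟩ := exists_eq_subgradient_add_normal (g := fun v => P.h (x + v))
    (by simpa using hP.convexOn_linearized 0 x) (Submodule.convex (tangentSpaceAt P.M x)) hv
    (c := -(P.gradX x y) - β • v) (fun w hw => by
      have := hvar w hw
      rw [inner_sub_left, inner_neg_left, real_inner_smul_left, inner_sub_right (P.gradX x y)]
      linarith)
  refine ⟨b, fun w => ?_, n, ?_, ?_⟩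
  · have := hb (w - x)
    simp only [add_sub_cancel] at this
    rwa [sub_sub] at this
  · rw [Submodule.mem_orthogonal]
    intro w hw
    have h1 := hn (v + w) (Submodule.add_mem _ hv hw)
    have h2 := hn (v - w) (Submodule.sub_mem _ hv hw)
    rw [add_sub_cancel_left] at h1
    rw [sub_sub_cancel_left, inner_neg_right] at h2
    rw [real_inner_comm]
    linarith
  · rw [add_assoc, ← e]
    abel

lemma bddAbove_Φ (hP : P.Standing Lx Ly Lh) (x : E₁) :
    BddAbove ((fun y => P.f x y - P.g y) '' P.S) :=
  (hP.compact_S.image ((hP.f_C1.continuous.comp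
    (by fun_prop : Continuous fun y : E₂ => (x, y))).sub hP.continuous_g)).bddAbove

/-- A small dual residual makes `y` an approximate maximizer at every nearby `x'`, by concavity. -/
lemma Φ_le_of_mem_dualResidual (hP : P.Standing Lx Ly Lh)
    (hY : P.LipschitzGradY Set.univ Ly) (x x' : E₁) {y z : E₂} (hy : y ∈ P.S)
    (hz : z ∈ P.dualResidual x y) :
    P.Φ x' ≤ P.f x' y - P.g y + (‖z‖ + Ly * ‖x' - x‖) * (2 * P.σy) := by
  refine csSup_le (Set.Nonempty.image _ ⟨y, hy⟩) ?_
  rintro _ ⟨w, hw, rfl⟩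
  obtain ⟨a, ha, b, hb, rfl⟩ := hz
  have hconv : ConvexOn ℝ Set.univ (fun z => -P.f x' z) := (hP.f_concave x').neg
  have hneg : ∀ z, HasGradientAt (fun z => -P.f x' z) (-P.gradY x' z) z :=
    fun z => hasGradientAt_neg (hP.hasGradientAt_gradY x' z)
  have h1 := ConvexOn.add_inner_gradient_le hneg hconv y w
  have h2 := ha w
  have h3 := hb w hw
  have h4 := real_inner_le_norm (P.gradY x y - a - b) (w - y)
  have h5 := real_inner_le_norm (P.gradY x' y - P.gradY x y) (w - y)
  have h6 := hP.norm_gradY_sub_le' hY (Set.mem_univ x') (Set.mem_univ x) hy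
  have h7 := hP.norm_sub_le_two_σy hw hy
  have h8 := mul_le_mul_of_nonneg_left h7 (norm_nonneg (P.gradY x y - a - b))
  have h9 := mul_le_mul h6 h7 (norm_nonneg _) (mul_nonneg hP.Ly_pos.le (norm_nonneg _))
  rw [inner_neg_left] at h1
  simp only [inner_sub_left] at h4 h5
  linarith

/-- Tangents of `f(·, y)` are approximate subgradients of `Φ` when `y` is an approximate maximizer,
since `f(·, y)` minorizes `Φ + g(y)` up to the curvature `L_x`. -/
lemma gradX_mem_epsSubdiffΦ (hP : P.Standing Lx Ly Lh) (hX : P.LipschitzGradX Set.univ Lx)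
    {x : E₁} {y : E₂} (hy : y ∈ P.S) {ε : ℝ} (h : P.Φ x ≤ P.f x y - P.g y + ε) :
    P.gradX x y ∈ P.epsSubdiffΦ Lx ε x := by
  intro w
  have h1 : P.f w y - P.g y ≤ P.Φ w := le_csSup (hP.bddAbove_Φ w) ⟨y, hy, rfl⟩
  have hneg : ∀ z, HasGradientAt (fun z => -P.f z y) (-P.gradX z y) z :=
    fun z => hasGradientAt_neg (hP.hasGradientAt_gradX y z)
  have h2 := le_of_gradient_lipschitz_segment hneg (L := Lx) (a := x) (b := w) (by
    intro t ht
    have := hX x (Set.mem_univ _) (x + t • (w - x)) (Set.mem_univ _) y hy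
    rw [neg_sub_neg]
    rwa [sub_add_cancel_left, norm_neg, norm_smul, Real.norm_of_nonneg ht.1] at this)
  rw [inner_neg_left] at h2
  linarith

/-- Game stationarity at the scale `ε / C` gives optimization stationarity at the scale `ε`, with
the proximal direction as the shift `u`. -/
lemma exists_opt_bound (hP : P.Standing Lx Ly Lh) (hA : A.Admissible Ly)
    (hR : IsRetraction P.M R) (hX : P.LipschitzGradX Set.univ Lx)
    (hY : P.LipschitzGradY Set.univ Ly) : ∃ K : ℝ, 0 < K ∧
      ∀ (l : ℕ → ℝ) (x : ℕ → E₁) (y : ℤ → E₂), P.IsRun R A l x y → ∀ ε : ℝ, 0 < ε →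
        ∃ k : ℕ, (k : ℝ) ≤ K / ε ^ 4 ∧ P.IsOptStationary Lx ε (x k) := by
  obtain ⟨K, hK, hgood⟩ := hP.exists_good_bound hA hR
  have hLx := hP.Lx_pos
  have hLy := hP.Ly_pos
  have hσ := hP.σy_nonneg
  have hγ := hA.γ_pos (k := -1) le_rfl
  have hl := hA.lmin_pos
  -- `‖v_k‖ ≤ s · ‖β_k v_k‖`
  set s := A.γ (-1) ^ 2 / A.lmin with hs
  have hs0 : 0 < s := by positivity
  set C := (1 + s) * (1 + Lx) + (1 + Ly * s) * (2 * P.σy) with hC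
  have hC0 : 0 < C := by positivity
  refine ⟨K * C ^ 4, by positivity, fun l x y hrun ε hε => ?_⟩
  obtain ⟨k, hk, hkg⟩ := hgood l x y hrun (ε / C) (by positivity)
  refine ⟨k, by rwa [div_pow, div_div_eq_mul_div] at hk, ?_⟩
  obtain ⟨h1, -, -⟩ := hP.run_mem hA hR hrun k
  have hyS := hP.run_y_mem hA hR hrun k
  have hβ := β_pos hA hrun.l_mem k
  obtain ⟨b, hb, n, hn, hopt⟩ := hP.proxDir_optimality hβ (x k) (y k)
  rw [goodIndices, Set.mem_ofPred_eq, gameMeasure, max_lt_iff,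
    ENNReal.ofReal_lt_ofReal_iff (by positivity), Metric.infEDist_lt_iff] at hkg
  obtain ⟨hv, z, hz, hzlt⟩ := hkg
  rw [edist_dist, dist_zero_left, ENNReal.ofReal_lt_ofReal_iff (by positivity)] at hzlt
  set v := P.proxDir (A.β l k) (x k) (y k)
  set δ := ε / C with hδ
  have hδ0 : 0 < δ := by positivity
  have hδC : δ * C = ε := by rw [hδ]; field_simp
  have hvn : ‖v‖ ≤ s * ‖A.β l k • v‖ := by
    rw [norm_smul, Real.norm_of_nonneg hβ.le, ← mul_assoc]
    refine le_mul_of_one_le_left (norm_nonneg v) ?_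
    have hγk := hA.γ_pos (k := (k : ℤ)) (by omega)
    rw [hs, Params.β, div_mul_div_comm, one_le_div (by positivity),
      mul_comm (A.γ (-1) ^ 2)]
    exact mul_le_mul (hrun.l_mem k).1
      (pow_le_pow_left₀ hγk.le (hA.γ_anti le_rfl (by omega)) 2) (by positivity)
      (hl.le.trans (hrun.l_mem k).1)
  have hvs : ‖v‖ ≤ s * δ := hvn.trans (mul_le_mul_of_nonneg_left hv.le hs0.le)
  have hc2 : 0 ≤ δ * ((1 + Ly * s) * (2 * P.σy)) := by positivity
  have hc1 : 0 < δ * (1 + Lx) := by positivity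
  have hc3 : 0 < δ * (s * Lx) := by positivity
  have hc4 : 0 < δ * Lx := by positivity
  have hc5 : 0 < δ * s := by positivity
  have hCexp : ε = δ + δ * Lx + δ * s + δ * (s * Lx) + δ * ((1 + Ly * s) * (2 * P.σy)) := by
    rw [← hδC, hC]; ring
  refine ⟨h1, v, by linarith, ?_⟩
  have hΦ : P.Φ (x k + v) ≤ P.f (x k + v) (y k) - P.g (y k) + ε := by
    refine (hP.Φ_le_of_mem_dualResidual hY (x k) (x k + v) hyS hz).trans ?_
    rw [add_sub_cancel_left]
    have h2 : ‖z‖ + Ly * ‖v‖ ≤ δ * (1 + Ly * s) := by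
      have := mul_le_mul_of_nonneg_left hvs hLy.le
      linarith
    have h3 := mul_le_mul_of_nonneg_right h2 (by positivity : 0 ≤ 2 * P.σy)
    linarith
  have hmem : P.gradX (x k + v) (y k) + b + n ∈ P.primalResidual Lx ε (x k) v :=
    ⟨_, hP.gradX_mem_epsSubdiffΦ hX hyS hΦ, b, hb, n, hn, rfl⟩
  refine (Metric.infEDist_le_edist_of_mem hmem).trans_lt ?_
  rw [edist_dist, dist_zero_left, ENNReal.ofReal_lt_ofReal_iff hε]
  have e : P.gradX (x k + v) (y k) + b + n
      = (P.gradX (x k + v) (y k) - P.gradX (x k) (y k)) + -(A.β l k • v) := by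
    rw [← hopt]; abel
  rw [e]
  refine (norm_add_le _ _).trans_lt ?_
  rw [norm_neg]
  have h2 := hX (x k + v) (Set.mem_univ _) (x k) (Set.mem_univ _) (y k) hyS
  rw [add_sub_cancel_left] at h2
  have h3 := mul_le_mul_of_nonneg_left hvs hLx.le
  linarith

end Problem.Standing

end ManifoldMinimax

theorem mainTheorem2 {E₁ E₂ : Type*}
    [NormedAddCommGroup E₁] [InnerProductSpace ℝ E₁] [FiniteDimensional ℝ E₁]
    [NormedAddCommGroup E₂] [InnerProductSpace ℝ E₂] [FiniteDimensional ℝ E₂]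
    (P : ManifoldMinimax.Problem E₁ E₂) (Lx Ly Lh : ℝ) (hP : P.Standing Lx Ly Lh)
    (R : E₁ → E₁ → E₁) (hR : ManifoldMinimax.IsRetraction P.M R)
    (A : ManifoldMinimax.Params) (hA : A.Admissible Ly) :
    -- the constants of the retraction exist
    (∃ M₁ M₂ : ℝ, ManifoldMinimax.RetractionBounds P.M R M₁ M₂) ∧
    -- the algorithm is well defined for all initial points and all choices of the `l_k`
    (∀ l : ℕ → ℝ, (∀ k, l k ∈ Set.Icc A.lmin A.lmax) → ∀ x₀ ∈ P.M, ∀ y₀ ∈ P.S,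
      ∃ (x : ℕ → E₁) (y : ℤ → E₂), P.IsRun R A l x y ∧ x 0 = x₀ ∧ y (-1) = y₀) ∧
    -- the bound on `T(ε)`
    (∀ M₁ M₂ : ℝ, ManifoldMinimax.RetractionBounds P.M R M₁ M₂ →
      ∀ (l : ℕ → ℝ) (x : ℕ → E₁) (y : ℤ → E₂), P.IsRun R A l x y → ∀ ε : ℝ, 0 < ε →
        (P.goodIndices A l x y ε).Nonempty ∧
        (P.T A l x y ε : ℝ) ≤
          ((15 + 4 * A.κ) ^ (1 / 4 : ℝ)
              * (2 * (P.Fupper A - P.Flower A) / P.C₁ A Lx Ly Lh M₁ M₂) ^ (1 / 2 : ℝ)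
              * (A.ρ * Ly + 1)
            + 2 * P.σy / A.ρ) ^ 4 / ε ^ 4) ∧
    -- an `ε`-game-stationary point within `O(ε⁻⁴)` outer iterations
    (∃ K : ℝ, 0 < K ∧
      ∀ (l : ℕ → ℝ) (x : ℕ → E₁) (y : ℤ → E₂), P.IsRun R A l x y → ∀ ε : ℝ, 0 < ε →
        ∃ k : ℕ, (k : ℝ) ≤ K / ε ^ 4 ∧ P.IsGameStationary ε (x k) (y k)) ∧
    -- an `ε`-optimization-stationary point within `O(ε⁻⁴)` outer iterations
    (P.LipschitzGradX Set.univ Lx → P.LipschitzGradY Set.univ Ly →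
      ∃ K : ℝ, 0 < K ∧
        ∀ (l : ℕ → ℝ) (x : ℕ → E₁) (y : ℤ → E₂), P.IsRun R A l x y → ∀ ε : ℝ, 0 < ε →
          ∃ k : ℕ, (k : ℝ) ≤ K / ε ^ 4 ∧ P.IsOptStationary Lx ε (x k)) := by
  exact ⟨hR.exists_bounds hP.compact_M,
    fun l hl x₀ hx₀ y₀ hy₀ => hP.exists_isRun hA hR hl hx₀ hy₀,
    fun M₁ M₂ hM l x y hrun ε hε => hP.run_T_le hA hR hM hrun hε,
    hP.exists_isGameStationary_bound hA hR,
    fun hX hY => hP.exists_opt_bound hA hR hX hY⟩
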